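/- Let $\mathbb{T}$ be the triangular lattice with edge-length $1$ and vertical edges, placed so that the origin $0$ is the midpoint of a vertical edge, and let $\mathbb{H}$ be the hexagonal lattice dual to it (vertices of $\mathbb{H}$ are the triangles of $\mathbb{T}$, edges of $\mathbb{H}$ cross the sides of the triangles at their midpoints). For an integer $T\ge 1$ let $S_T$ be the vertical strip $\{0\le x\le \tfrac{\sqrt3}{2}T\}$, which consists of $T$ columns of triangles. A self-avoiding bridge of width $T$ is a self-avoiding walk $\gamma$ on $\mathbb{H}$ that stays in $S_T$, starts at $0$ on the left boundary of $S_T$, and ends at the midpoint of an edge of $\mathbb{T}$ on the right boundary of $S_T$. Let $|\gamma|$ be its number of edges, the two half-edges at its ends counting together as one; equivalently, $|\gamma|$ is the number of vertices of $\mathbb{H}$ that $\gamma$ visits. Let $$B_T=\sum_{\gamma\text{ bridge of width }T}\Big(\frac{1}{\sqrt{2+\sqrt2}}\Big)^{|\gamma|}\in[0,\infty]$$ be the critical partition function of bridges of width $T$. Then $$\sum_{T\ge1}\frac1T\,B_T^{\,3}<\infty ;$$ in particular every $B_T$ is finite. Moreover $B_T\to0$ as $T\to\infty$, and $B_T<\dfrac{1}{(\log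 T)^{1/3}}$ for infinitely many integers $T\ge 2$. -/

import Mathlib

open Filter Topology
open scoped ENNReal

/-- The vertices of the hexagonal lattice, that is, the faces of the triangular lattice with
edge-length `1` that has vertical edges.  Column `k` is `√3/2 * k ≤ x ≤ √3/2 * (k + 1)`.
It is a stack of rhombi, the one in row `n` having the vertical side with midpoint
`(√3/2 * k, n - k/2)` on its left, and upper-left angle `π/3`.  Its short diagonal splits it into
* `left k n`, the triangle that contains the left side of the rhombus, with centre
  `(√3/2 * k + √3/6, n - k/2)`;
* `right k n`, the triangle that contains the right side of the rhombus, with centre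
  `(√3/2 * k + √3/3, n - k/2 - 1/2)`. -/
inductive HexVertex : Type
  | left (k n : ℤ) : HexVertex
  | right (k n : ℤ) : HexVertex

namespace HexVertex

/-- The column in which a vertex lies. -/
def col : HexVertex → ℤ
  | left k _ => k
  | right k _ => k

/-- Adjacency: the triangle `left k n` shares its lower side (the diagonal of the rhombus) with
`right k n`, its upper side with `right k (n + 1)` and its vertical side with `right (k - 1) n`. -/
def Adj : HexVertex → HexVertex → Prop
  | left k n, right k' n' =>
      (k' = k ∧ n' = n) ∨ (k' = k ∧ n' = n + 1) ∨ (k' = k - 1 ∧ n' = n)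
  | right k' n', left k n =>
      (k' = k ∧ n' = n) ∨ (k' = k ∧ n' = n + 1) ∨ (k' = k - 1 ∧ n' = n)
  | left _ _, left _ _ => False
  | right _ _, right _ _ => False

end HexVertex

/-- The hexagonal lattice. -/
def hexLattice : SimpleGraph HexVertex where
  Adj := HexVertex.Adj
  symm := ⟨by
    intro u v h
    cases u <;> cases v <;> exact h⟩
  loopless := ⟨by
    intro u h
    cases u <;> exact h⟩

/-- A self-avoiding bridge of width `T`: a self-avoiding walk in the strip consisting of the columns
`0, …, T - 1`, from the origin (the midpoint of the left side of `left 0 0`) to the midpoint of an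
edge of the right boundary of the strip (the right side of `right (T - 1) n` for some row `n`).
It is recorded by the path of vertices of the hexagonal lattice that it visits. -/
structure HexBridge (T : ℕ) where
  /-- The row of the endpoint. -/
  row : ℤ
  /-- The vertices that are visited. -/
  walk : hexLattice.Walk (HexVertex.left 0 0) (HexVertex.right ((T : ℤ) - 1) row)
  selfAvoiding : walk.IsPath
  inStrip : ∀ v ∈ walk.support, 0 ≤ v.col ∧ v.col < (T : ℤ)

/-- The number of edges of a bridge.  Its first and last steps, from a boundary midpoint to the
adjacent vertex, are half-edges, which together count for one edge. -/
def HexBridge.length {T : ℕ} (γ : HexBridge T) : ℕ := γ.walk.length + 1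

/-- The critical weight per edge `1 / √(2 + √2)` of the regular self-avoiding walk. -/
noncomputable def hexCriticalWeight : ℝ := 1 / √(2 + √2)

/-- The partition function `B_T(π/3)` of self-avoiding bridges of width `T`, with values in
`[0, ∞]`. -/
noncomputable def bridgePartition (T : ℕ) : ℝ≥0∞ :=
  ∑' γ : HexBridge T, ENNReal.ofReal (hexCriticalWeight ^ γ.length)

/-!
The proof compares bridges with *arcs*: self-avoiding walks from the origin that stay in the
half-plane on its right and end on the boundary of that half-plane.

A walk is encoded by the list of its left and right turns (`run`, `trail`), which makes rotations,
translations and concatenations transparent.  Let `x` be the critical weight, and give a walk of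
length `n` with winding `wπ/3` the weight `x ^ n * exp (iπw/8)`.  This is the parafermionic
observable of spin `5/8`, multiplied by the direction of the last edge.  In a finite domain with
the origin on its boundary, the walks that leave the domain have total weight `1`
(`sum_weight_exits`): the two extensions of a walk by one turn together weigh as much as the walk,
as `2 x cos (π/8) = 1`, and the walks that run into themselves cancel in pairs, because reversing
a loop changes `w` by `8`.

Both the cancellation and the use of the identity need the exact winding of a self-avoiding walk.
It comes from a discrete form of Hopf's theorem on turning tangents (`wind_eq_view`): the total
turning of a simple path is the sum of the angles by which the rest of the path is seen to turn
from its two ends.  For a path between boundary points of a convex domain these angles are at most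
`π/2` (`abs_wind_le`).  For a loop, the tail that joins it to the boundary lies outside,
which fixes the orientation of the loop (`wind_loop`).

In a strip of width `T` the identity yields `c A_T + B_T ≤ 1`, where `c = cos (3π/8)` and `A_T` is
the partition function of the arcs in the strip (`arcs_add_bridges_le`).  Hence `B_T` is at most
the deficit `1 - c A_T`, which decreases in `T`.  In an equilateral triangle with the origin at
the midpoint of a side, the identity shows that the walks that leave through a given one of the
two other sides have weight at least `x` times the deficit of a strip that contains the triangle
(`deficit_le_upSum`).

Three such walks make an arc (`glue_mem_arcsAt`).  The first crosses a triangle of size `s` to its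
upper side.  The second one starts there and crosses a triangle whose size is adapted such that it
has the same upper left corner; the third one does likewise.  The three triangles lie in the three
sectors of angle `π/3` at the common corner, so the third walk ends on the boundary of the
half-plane.  As an arc can be cut in at most one way for each `s`, the arcs that end at heights of
order `s` have total weight at least `x ^ 3` times the cube of the deficit at `8 s + 1`
(`deficit_pow_three_le`).  An arc is counted in this way only for `s` between a ninth of its
height and its height, and the sum of `1 / s` over this range is at most `9`.  Since the arcs have
finite total weight, the sum of `1 / T` times the cube of the deficit at `T` is finite
(`tsum_deficit_ne_top`).  Monotonicity of the deficits and comparison with the harmonic series, by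
Cauchy condensation, give the other two assertions.
-/

namespace HexSAW

/-! ### The triangular grid and its angles -/

/-- Points of the triangular grid `ℤ[ω]`, `ω = exp(iπ/3)`: the pair `(a, b)` stands for `a + bω`. -/
abbrev Pt : Type := ℤ × ℤ

/-- The primitive sixth root of unity `exp(iπ/3)`. -/
noncomputable def omega : ℂ :=
  Complex.cos (Real.pi / 3 : ℝ) + Complex.sin (Real.pi / 3 : ℝ) * Complex.I

/-- The complex number `a + bω` that a grid point stands for. -/
noncomputable def toC (z : Pt) : ℂ := z.1 + z.2 * omega

/-- Rotation by `π/3`, counterclockwise (a left turn) for `true` and clockwise for `false`. -/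
def rot (t : Bool) (z : Pt) : Pt := if t then (-z.2, z.1 + z.2) else (z.1 + z.2, -z.1)

@[simp] lemma rot_true (z : Pt) : rot true z = (-z.2, z.1 + z.2) := rfl
@[simp] lemma rot_false (z : Pt) : rot false z = (z.1 + z.2, -z.1) := rfl

lemma omega_re : omega.re = 1 / 2 := by
  rw [omega, ← Complex.ofReal_cos, ← Complex.ofReal_sin]
  simp [Real.cos_pi_div_three]

lemma omega_im : omega.im = √3 / 2 := by
  rw [omega, ← Complex.ofReal_cos, ← Complex.ofReal_sin]
  simp [Real.sin_pi_div_three]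

lemma arg_omega : omega.arg = Real.pi / 3 :=
  Complex.arg_cos_add_sin_mul_I ⟨by linarith [Real.pi_pos], by linarith [Real.pi_pos]⟩

lemma sqrt_three_sq : √3 * √3 = (3 : ℝ) := Real.mul_self_sqrt (by norm_num)

lemma omega_sq : omega * omega = omega - 1 := by
  apply Complex.ext
  · simp only [Complex.mul_re, Complex.sub_re, omega_re, omega_im, Complex.one_re]
    linarith [sqrt_three_sq]
  · simp only [Complex.mul_im, Complex.sub_im, omega_re, omega_im, Complex.one_im]
    ring

lemma toC_re (z : Pt) : (toC z).re = z.1 + z.2 / 2 := by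
  simp [toC, omega_re]; ring

lemma toC_im (z : Pt) : (toC z).im = z.2 * (√3 / 2) := by
  simp [toC, omega_im]

lemma toC_ne_zero {z : Pt} (h : z ≠ 0) : toC z ≠ 0 := by
  intro h0
  apply h
  have h1 := congrArg Complex.im h0
  have h2 := congrArg Complex.re h0
  rw [toC_im] at h1
  rw [toC_re] at h2
  have h3 : (z.2 : ℝ) = 0 := by
    rcases mul_eq_zero.1 h1 with h | h
    · exact h
    · exact absurd h (by positivity)
  rw [h3] at h2
  simp only [zero_div, add_zero, Complex.zero_re] at h2
  exact Prod.ext (by exact_mod_cast h2) (by exact_mod_cast h3)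

lemma toC_neg (z : Pt) : toC (-z) = -toC z := by
  simp [toC]; ring

lemma toC_rot_true (z : Pt) : toC (rot true z) = omega * toC z := by
  simp only [toC, rot_true]
  push_cast
  linear_combination -(z.2 : ℂ) * omega_sq

lemma toC_rot_false (z : Pt) : omega * toC (rot false z) = toC z := by
  simp only [toC, rot_false]
  push_cast
  linear_combination -(z.1 : ℂ) * omega_sq

/-- The angle in `(-π, π]` from the vector `z` to the vector `w`. -/
noncomputable def ang (z w : Pt) : ℝ := (toC w / toC z).arg

lemma ang_neg (z w : Pt) : ang (-z) (-w) = ang z w := by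
  simp [ang, toC_neg]

lemma ang_sub_comm (p q r s : Pt) : ang (p - q) (r - s) = ang (q - p) (s - r) := by
  rw [← ang_neg, neg_sub, neg_sub]

lemma ang_self {z : Pt} (h : z ≠ 0) : ang z z = 0 := by
  simp [ang, toC_ne_zero h]

lemma ang_rot_true {z : Pt} (h : z ≠ 0) : ang z (rot true z) = Real.pi / 3 := by
  rw [ang, toC_rot_true, mul_div_assoc, div_self (toC_ne_zero h), mul_one, arg_omega]

lemma ang_rot_false {z : Pt} (h : z ≠ 0) : ang z (rot false z) = -(Real.pi / 3) := by
  have h0 := toC_ne_zero h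
  have h1 : omega ≠ 0 := by
    intro h2
    have := toC_rot_false z
    rw [h2, zero_mul] at this
    exact h0 this.symm
  have h2 : toC (rot false z) / toC z = omega⁻¹ := by
    rw [← toC_rot_false z] at h0 ⊢
    have h3 := right_ne_zero_of_mul h0
    field_simp
  rw [ang, h2, Complex.arg_inv, arg_omega, if_neg (by linarith [Real.pi_pos])]

/-- On an open half-plane the angle between two vectors is a difference of arguments for a
suitable branch of the argument. -/
lemma exists_lift (α β : ℤ) : ∃ θ : Pt → ℝ, ∀ z w : Pt, 0 < α * z.1 + β * z.2 →
    0 < α * w.1 + β * w.2 → ang z w = θ w - θ z := by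
  -- `c` is chosen such that `Re (c (a + bω)) = αa + βb`
  obtain ⟨c, hc⟩ : ∃ c : ℂ, ∀ z : Pt, (c * toC z).re = α * z.1 + β * z.2 := by
    refine ⟨⟨α, (α - 2 * β) / √3⟩, fun z => ?_⟩
    have h3 : (√3 : ℝ) ≠ 0 := by positivity
    rw [Complex.mul_re, toC_re, toC_im]
    field_simp
    ring
  refine ⟨fun z => (c * toC z).arg, fun z w hz hw => ?_⟩
  have hz' : 0 < (c * toC z).re := by rw [hc]; exact_mod_cast hz
  have hw' : 0 < (c * toC w).re := by rw [hc]; exact_mod_cast hw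
  have hz0 : c * toC z ≠ 0 := fun h => by simp [h] at hz'
  have hw0 : c * toC w ≠ 0 := fun h => by simp [h] at hw'
  have h1 := abs_lt.1 (Complex.abs_arg_lt_pi_div_two_iff.2 (Or.inl hz'))
  have h2 := abs_lt.1 (Complex.abs_arg_lt_pi_div_two_iff.2 (Or.inl hw'))
  have h3 : toC w / toC z = (c * toC w) * (c * toC z)⁻¹ := by
    have := left_ne_zero_of_mul hz0
    have := right_ne_zero_of_mul hz0
    field_simp
  have h4 : (c * toC z)⁻¹.arg = -(c * toC z).arg := by
    rw [Complex.arg_inv, if_neg (by linarith)]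
  rw [ang, h3, (Complex.arg_mul_eq_add_arg_iff hw0 (inv_ne_zero hz0)).2, h4, sub_eq_add_neg]
  rw [h4]
  exact ⟨by linarith, by linarith⟩

lemma ang_add {u v w : Pt} (α β : ℤ) (hu : 0 < α * u.1 + β * u.2) (hv : 0 < α * v.1 + β * v.2)
    (hw : 0 < α * w.1 + β * w.2) : ang u v + ang v w = ang u w := by
  obtain ⟨θ, h⟩ := exists_lift α β
  rw [h _ _ hu hv, h _ _ hv hw, h _ _ hu hw]
  ring

/-! ### Angles of view -/

/-- The total angle by which the line of sight from `z` turns while its endpoint runs through a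
path.  Paths are listed from their last point to their first. -/
noncomputable def view (z : Pt) : List Pt → ℝ
  | [] => 0
  | [_] => 0
  | q :: q' :: l => ang (q' - z) (q - z) + view z (q' :: l)

@[simp] lemma view_singleton (z q : Pt) : view z [q] = 0 := rfl

@[simp] lemma view_cons_cons (z q q' : Pt) (l : List Pt) :
    view z (q :: q' :: l) = ang (q' - z) (q - z) + view z (q' :: l) := rfl

lemma view_append_singleton (z q e : Pt) (l : List Pt) :
    view z ((q :: l) ++ [e]) =
      view z (q :: l) + ang (e - z) ((q :: l).getLast (List.cons_ne_nil _ _) - z) := by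
  induction l generalizing q with
  | nil => simp
  | cons r l ih =>
    have := ih r
    simp only [List.cons_append, view_cons_cons] at this ⊢
    rw [this, List.getLast_cons (List.cons_ne_nil _ _)]
    ring

/-- If a path lies in an open half-plane as seen from `z`, then the line of sight turns by the angle
between its end positions. -/
lemma view_of_halfPlane {z : Pt} (α β : ℤ) (q : Pt) (l : List Pt)
    (h : ∀ p ∈ q :: l, 0 < α * (p - z).1 + β * (p - z).2) :
    view z (q :: l) = ang ((q :: l).getLast (List.cons_ne_nil _ _) - z) (q - z) := by
  induction l generalizing q with
  | nil =>
    have h1 := h q (by simp)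
    rw [view_singleton, List.getLast_singleton, ang_self]
    intro h0
    rw [h0] at h1
    simp at h1
  | cons r l ih =>
    rw [view_cons_cons, ih r fun p hp => h p (List.mem_cons_of_mem _ hp),
      List.getLast_cons (List.cons_ne_nil _ _), add_comm]
    exact ang_add α β (h _ (List.mem_cons_of_mem _ (List.getLast_mem _))) (h r (by simp))
      (h q (by simp))

/-- The segments `[z, z']` and `[q, q']` are separated by a line. -/
def Sep (z z' q q' : Pt) : Prop :=
  ∃ α β : ℤ, 0 < α * (q - z).1 + β * (q - z).2 ∧ 0 < α * (q' - z).1 + β * (q' - z).2 ∧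
    0 < α * (q - z').1 + β * (q - z').2 ∧ 0 < α * (q' - z').1 + β * (q' - z').2

/-- Moving the point of view from `z` to `z'` changes the angle of view only by the changes of the
directions to the two ends of the path, if the segment `[z, z']` does not meet the path. -/
lemma view_move {z z' : Pt} (q : Pt) (l : List Pt) (h : (q :: l).IsChain (Sep z z')) :
    view z' (q :: l) = view z (q :: l) + ang (q - z) (q - z')
      - ang ((q :: l).getLast (List.cons_ne_nil _ _) - z)
        ((q :: l).getLast (List.cons_ne_nil _ _) - z') := by
  induction l generalizing q with
  | nil => simp
  | cons r l ih =>
    rw [List.isChain_cons_cons] at h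
    rw [view_cons_cons, view_cons_cons, ih r h.2, List.getLast_cons (List.cons_ne_nil _ _)]
    obtain ⟨⟨α, β, h1, h2, h3, h4⟩, -⟩ := h
    have e1 := ang_add α β h2 h1 h3
    have e2 := ang_add α β h2 h4 h3
    linarith

/-! ### The hexagonal lattice in the grid -/

/-- The three steps of the hexagonal lattice out of a vertex `(a, b)` with `a ≡ b` modulo `3`. -/
def IsStep (d : Pt) : Prop := d = (1, 0) ∨ d = (-1, 1) ∨ d = (0, -1)

/-- An edge of the hexagonal lattice whose vertices are the grid points `(a, b)` with
`a - b ≢ 2` modulo `3`, traversed from `p` to `q`. -/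
def Adj (p q : Pt) : Prop :=
  (3 ∣ p.1 - p.2 ∧ IsStep (q - p)) ∨ (3 ∣ q.1 - q.2 ∧ IsStep (p - q))

lemma Adj.symm {p q : Pt} (h : Adj p q) : Adj q p := Or.symm h

lemma sep_of_steps {p q d e : Pt} (hp : 3 ∣ p.1 - p.2) (hq : 3 ∣ q.1 - q.2)
    (hd : IsStep d) (he : IsStep e) (h1 : p ≠ q) (h2 : p + d ≠ q + e) :
    Sep p (p + d) q (q + e) := by
  obtain ⟨p1, p2⟩ := p
  obtain ⟨x, hx⟩ : ∃ x, q.1 = p1 + x := ⟨q.1 - p1, by ring⟩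
  obtain ⟨y, hy⟩ : ∃ y, q.2 = p2 + y := ⟨q.2 - p2, by ring⟩
  obtain ⟨q1, q2⟩ := q
  subst hx hy
  have key : ∀ α β : ℤ, 0 < α * x + β * y → 0 < α * (x + e.1) + β * (y + e.2) →
      0 < α * (x - d.1) + β * (y - d.2) → 0 < α * (x + e.1 - d.1) + β * (y + e.2 - d.2) →
      Sep (p1, p2) ((p1, p2) + d) (p1 + x, p2 + y) ((p1 + x, p2 + y) + e) := by
    intro α β e1 e2 e3 e4
    refine ⟨α, β, ?_, ?_, ?_, ?_⟩ <;>
      simp only [Prod.fst_sub, Prod.snd_sub, Prod.fst_add, Prod.snd_add]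
    · convert e1 using 1; ring
    · convert e2 using 1; ring
    · convert e3 using 1; ring
    · convert e4 using 1; ring
  have hxy : 3 ∣ x - y := by simp only at hp hq; omega
  have h1 : ¬(x = 0 ∧ y = 0) := fun h => h1 (by simp [h.1, h.2])
  have h2 : ¬(x + e.1 - d.1 = 0 ∧ y + e.2 - d.2 = 0) := fun h =>
    h2 (Prod.ext (by simp only [Prod.fst_add]; omega) (by simp only [Prod.snd_add]; omega))
  clear hp hq
  -- a separating line can be chosen parallel to one of the edges or, if they are collinear, in
  -- another lattice direction
  rcases hd with rfl | rfl | rfl <;> rcases he with rfl | rfl | rfl <;> simp only at key h1 h2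
  · have : 0 < y ∨ 0 < -y ∨ 1 < x ∨ 1 < -x := by omega
    rcases this with h | h | h | h
    · exact key 0 1 (by omega) (by omega) (by omega) (by omega)
    · exact key 0 (-1) (by omega) (by omega) (by omega) (by omega)
    · exact key 1 0 (by omega) (by omega) (by omega) (by omega)
    · exact key (-1) 0 (by omega) (by omega) (by omega) (by omega)
  · have : 0 < y ∨ 1 < -y ∨ 1 < x + y ∨ 0 < -x - y := by omega
    rcases this with h | h | h | h
    · exact key 0 1 (by omega) (by omega) (by omega) (by omega)
    · exact key 0 (-1) (by omega) (by omega) (by omega) (by omega)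
    · exact key 1 1 (by omega) (by omega) (by omega) (by omega)
    · exact key (-1) (-1) (by omega) (by omega) (by omega) (by omega)
  · have : 1 < y ∨ 0 < -y ∨ 1 < x ∨ 0 < -x := by omega
    rcases this with h | h | h | h
    · exact key 0 1 (by omega) (by omega) (by omega) (by omega)
    · exact key 0 (-1) (by omega) (by omega) (by omega) (by omega)
    · exact key 1 0 (by omega) (by omega) (by omega) (by omega)
    · exact key (-1) 0 (by omega) (by omega) (by omega) (by omega)
  · have : 0 < x + y ∨ 1 < -x - y ∨ 1 < y ∨ 0 < -y := by omega
    rcases this with h | h | h | h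
    · exact key 1 1 (by omega) (by omega) (by omega) (by omega)
    · exact key (-1) (-1) (by omega) (by omega) (by omega) (by omega)
    · exact key 0 1 (by omega) (by omega) (by omega) (by omega)
    · exact key 0 (-1) (by omega) (by omega) (by omega) (by omega)
  · have : 0 < x + y ∨ 0 < -x - y ∨ 1 < x ∨ 1 < -x := by omega
    rcases this with h | h | h | h
    · exact key 1 1 (by omega) (by omega) (by omega) (by omega)
    · exact key (-1) (-1) (by omega) (by omega) (by omega) (by omega)
    · exact key 1 0 (by omega) (by omega) (by omega) (by omega)
    · exact key (-1) 0 (by omega) (by omega) (by omega) (by omega)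
  · have : 1 < x + y ∨ 0 < -x - y ∨ 0 < x ∨ 1 < -x := by omega
    rcases this with h | h | h | h
    · exact key 1 1 (by omega) (by omega) (by omega) (by omega)
    · exact key (-1) (-1) (by omega) (by omega) (by omega) (by omega)
    · exact key 1 0 (by omega) (by omega) (by omega) (by omega)
    · exact key (-1) 0 (by omega) (by omega) (by omega) (by omega)
  · have : 0 < x ∨ 1 < -x ∨ 0 < y ∨ 1 < -y := by omega
    rcases this with h | h | h | h
    · exact key 1 0 (by omega) (by omega) (by omega) (by omega)
    · exact key (-1) 0 (by omega) (by omega) (by omega) (by omega)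
    · exact key 0 1 (by omega) (by omega) (by omega) (by omega)
    · exact key 0 (-1) (by omega) (by omega) (by omega) (by omega)
  · have : 1 < x ∨ 0 < -x ∨ 0 < x + y ∨ 1 < -x - y := by omega
    rcases this with h | h | h | h
    · exact key 1 0 (by omega) (by omega) (by omega) (by omega)
    · exact key (-1) 0 (by omega) (by omega) (by omega) (by omega)
    · exact key 1 1 (by omega) (by omega) (by omega) (by omega)
    · exact key (-1) (-1) (by omega) (by omega) (by omega) (by omega)
  · have : 0 < x ∨ 0 < -x ∨ 1 < y ∨ 1 < -y := by omega
    rcases this with h | h | h | h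
    · exact key 1 0 (by omega) (by omega) (by omega) (by omega)
    · exact key (-1) 0 (by omega) (by omega) (by omega) (by omega)
    · exact key 0 1 (by omega) (by omega) (by omega) (by omega)
    · exact key 0 (-1) (by omega) (by omega) (by omega) (by omega)

lemma sep_of_adj {z z' q q' : Pt} (h : Adj z z') (h' : Adj q q') (h1 : z ≠ q) (h2 : z ≠ q')
    (h3 : z' ≠ q) (h4 : z' ≠ q') : Sep z z' q q' := by
  rcases h with ⟨a, b⟩ | ⟨a, b⟩ <;> rcases h' with ⟨c, d⟩ | ⟨c, d⟩
  · have := sep_of_steps a c b d h1 (by simpa)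
    simpa using this
  · obtain ⟨α, β, e1, e2, e3, e4⟩ := sep_of_steps a c b d h2 (by simpa)
    simp only [add_sub_cancel] at e1 e2 e3 e4
    exact ⟨α, β, e2, e1, e4, e3⟩
  · obtain ⟨α, β, e1, e2, e3, e4⟩ := sep_of_steps a c b d h3 (by simpa)
    simp only [add_sub_cancel] at e1 e2 e3 e4
    exact ⟨α, β, e3, e4, e1, e2⟩
  · obtain ⟨α, β, e1, e2, e3, e4⟩ := sep_of_steps a c b d h4 (by simpa)
    simp only [add_sub_cancel] at e1 e2 e3 e4
    exact ⟨α, β, e4, e3, e2, e1⟩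

lemma isChain_sep {z z' : Pt} {l : List Pt} (h : Adj z z') (hl : l.IsChain Adj) (h1 : z ∉ l)
    (h2 : z' ∉ l) : l.IsChain (Sep z z') := by
  induction l with
  | nil => exact .nil
  | cons q l ih =>
    cases l with
    | nil => exact .singleton _
    | cons r l =>
      rw [List.isChain_cons_cons] at hl ⊢
      simp only [List.mem_cons, not_or] at h1 h2
      exact ⟨sep_of_adj h hl.1 h1.1 h1.2.1 h2.1 h2.2.1,
        ih hl.2 (by simpa using h1.2) (by simpa using h2.2)⟩

/-! ### Walks as lists of turns -/

/-- A directed edge of the hexagonal lattice. -/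
@[ext] structure Dart where
  /-- The vertex at which the edge starts. -/
  src : Pt
  /-- The vector along the edge. -/
  dir : Pt

namespace Dart

/-- The vertex at which the edge ends. -/
def tgt (D : Dart) : Pt := D.src + D.dir

/-- The next directed edge after a turn to the left (`true`) or to the right (`false`). -/
def step (t : Bool) (D : Dart) : Dart := ⟨D.tgt, rot t D.dir⟩

/-- The same edge with the opposite direction. -/
def rev (D : Dart) : Dart := ⟨D.tgt, -D.dir⟩

/-- The directed edge does belong to the hexagonal lattice. -/
def Valid (D : Dart) : Prop :=
  (3 ∣ D.src.1 - D.src.2 ∧ IsStep D.dir) ∨ (3 ∣ D.tgt.1 - D.tgt.2 ∧ IsStep (-D.dir))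

@[simp] lemma step_src (t : Bool) (D : Dart) : (D.step t).src = D.tgt := rfl
@[simp] lemma step_dir (t : Bool) (D : Dart) : (D.step t).dir = rot t D.dir := rfl
@[simp] lemma rev_src (D : Dart) : D.rev.src = D.tgt := rfl
@[simp] lemma rev_dir (D : Dart) : D.rev.dir = -D.dir := rfl
@[simp] lemma rev_tgt (D : Dart) : D.rev.tgt = D.src := by simp [tgt]
@[simp] lemma rev_rev (D : Dart) : D.rev.rev = D := by ext <;> simp
@[simp] lemma tgt_sub_src (D : Dart) : D.tgt - D.src = D.dir := by simp [tgt]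

lemma Valid.adj {D : Dart} (h : D.Valid) : Adj D.src D.tgt := by
  unfold Adj
  rw [← neg_sub D.tgt D.src, D.tgt_sub_src]
  exact h

lemma Valid.step {D : Dart} (h : D.Valid) (t : Bool) : (D.step t).Valid := by
  obtain ⟨⟨s1, s2⟩, ⟨d1, d2⟩⟩ := D
  simp only [Valid, tgt, IsStep, step_src, step_dir] at h ⊢
  cases t <;> simp only [rot_true, rot_false, Prod.mk.injEq, Prod.mk_add_mk, Prod.neg_mk] at h ⊢ <;>
    omega

lemma Valid.dir_cases {D : Dart} (h : D.Valid) :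
    D.dir = (1, 0) ∨ D.dir = (0, 1) ∨ D.dir = (-1, 1) ∨ D.dir = (-1, 0) ∨ D.dir = (0, -1) ∨
      D.dir = (1, -1) := by
  obtain ⟨⟨s1, s2⟩, ⟨d1, d2⟩⟩ := D
  simp only [Valid, tgt, IsStep, Prod.mk.injEq, Prod.mk_add_mk, Prod.neg_mk] at h ⊢
  omega

lemma Valid.dir_ne_zero {D : Dart} (h : D.Valid) : D.dir ≠ 0 := by
  rcases h.dir_cases with h | h | h | h | h | h <;> rw [h] <;> decide

end Dart

/-- The last directed edge of the walk that starts along `D` and then takes the turns in `L`, which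
are listed from the last to the first. -/
def run (D : Dart) : List Bool → Dart
  | [] => D
  | t :: L => (run D L).step t

/-- The vertices at which the walk turns, from the last to the first.  These are all its vertices
except for the source of its first and the target of its last directed edge. -/
def trail (D : Dart) : List Bool → List Pt
  | [] => []
  | _ :: L => (run D L).tgt :: trail D L

/-- The number of left turns minus the number of right turns. -/
def wind : List Bool → ℤ
  | [] => 0
  | t :: L => (if t then 1 else -1) + wind L

@[simp] lemma run_nil (D : Dart) : run D [] = D := rfl
@[simp] lemma run_cons (D : Dart) (t : Bool) (L : List Bool) :
    run D (t :: L) = (run D L).step t := rfl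
@[simp] lemma trail_nil (D : Dart) : trail D [] = [] := rfl
@[simp] lemma trail_cons (D : Dart) (t : Bool) (L : List Bool) :
    trail D (t :: L) = (run D L).tgt :: trail D L := rfl
@[simp] lemma wind_nil : wind [] = 0 := rfl
@[simp] lemma wind_cons (t : Bool) (L : List Bool) :
    wind (t :: L) = (if t then 1 else -1) + wind L := rfl

lemma run_append (D : Dart) (L M : List Bool) : run D (L ++ M) = run (run D M) L := by
  induction L with
  | nil => rfl
  | cons t L ih => simp [ih]

lemma trail_append (D : Dart) (L M : List Bool) :
    trail D (L ++ M) = trail (run D M) L ++ trail D M := by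
  induction L with
  | nil => rfl
  | cons t L ih => simp [ih, run_append]

lemma wind_append (L M : List Bool) : wind (L ++ M) = wind L + wind M := by
  induction L with
  | nil => simp
  | cons t L ih => simp [ih]; ring

@[simp] lemma length_trail (D : Dart) (L : List Bool) : (trail D L).length = L.length := by
  induction L with
  | nil => rfl
  | cons t L ih => simp [ih]

lemma valid_run {D : Dart} (h : D.Valid) (L : List Bool) : (run D L).Valid := by
  induction L with
  | nil => exact h
  | cons t L ih => exact ih.step t

lemma trail_eq_src_cons (D : Dart) (t : Bool) (L : List Bool) :
    trail D (t :: L) = (run D (t :: L)).src :: trail D L := rfl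

lemma src_mem_trail_append (D : Dart) (L : List Bool) : (run D L).src ∈ trail D L ++ [D.src] := by
  cases L <;> simp

lemma trail_append_src_eq (D : Dart) (L : List Bool) :
    ∃ l, trail D L ++ [D.src] = (run D L).src :: l := by
  cases L <;> simp

lemma getLast_tgt_trail (D : Dart) (L : List Bool) :
    ((run D L).tgt :: trail D L).getLast (List.cons_ne_nil _ _) = D.tgt := by
  induction L with
  | nil => rfl
  | cons t L ih => rw [trail_cons, List.getLast_cons (List.cons_ne_nil _ _)]; exact ih

lemma isChain_verts {D : Dart} (h : D.Valid) (L : List Bool) :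
    ((run D L).tgt :: (trail D L ++ [D.src])).IsChain Adj := by
  induction L with
  | nil => simpa using h.adj.symm
  | cons t L ih =>
    rw [trail_cons, List.cons_append, List.isChain_cons_cons]
    exact ⟨(valid_run h (t :: L)).adj.symm, ih⟩

/-! ### Reversal of walks -/

/-- The turns of the reversed walk. -/
def revTurns (L : List Bool) : List Bool := L.reverse.map not

@[simp] lemma revTurns_revTurns (L : List Bool) : revTurns (revTurns L) = L := by
  simp [revTurns, List.map_reverse, Function.comp_def]

@[simp] lemma length_revTurns (L : List Bool) : (revTurns L).length = L.length := by
  simp [revTurns]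

lemma revTurns_cons (t : Bool) (L : List Bool) : revTurns (t :: L) = revTurns L ++ [!t] := by
  simp [revTurns]

lemma wind_revTurns (L : List Bool) : wind (revTurns L) = -wind L := by
  induction L with
  | nil => rfl
  | cons t L ih =>
    rw [revTurns_cons, wind_append, ih]
    cases t <;> simp

lemma step_not_rev_step (t : Bool) (D : Dart) : ((D.step t).rev).step (!t) = D.rev := by
  ext <;> cases t <;> simp [Dart.tgt] <;> ring

lemma run_revTurns (D : Dart) (L : List Bool) : run (run D L).rev (revTurns L) = D.rev := by
  induction L with
  | nil => rfl
  | cons t L ih =>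
    rw [revTurns_cons, run_append, run_cons, run_cons, run_nil, step_not_rev_step, ih]

lemma trail_revTurns (D : Dart) (L : List Bool) :
    trail (run D L).rev (revTurns L) = (trail D L).reverse := by
  induction L with
  | nil => rfl
  | cons t L ih =>
    rw [revTurns_cons, trail_append, run_cons, run_cons, run_nil, step_not_rev_step, ih]
    simp

/-! ### Winding of self-avoiding walks -/

lemma exists_halfPlane_rot {D : Dart} (h : D.Valid) (t : Bool) :
    ∃ α β : ℤ, 0 < α * D.dir.1 + β * D.dir.2 ∧
      0 < α * (rot t D.dir).1 + β * (rot t D.dir).2 := by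
  refine ⟨2 * (D.dir + rot t D.dir).1 + (D.dir + rot t D.dir).2,
    (D.dir + rot t D.dir).1 + 2 * (D.dir + rot t D.dir).2, ?_⟩
  rcases h.dir_cases with h | h | h | h | h | h <;> rw [h] <;> cases t <;> decide

/-- The turn from the edge `D` to the next edge, seen as a sum of two angles of the triangle that
the two edges span. -/
lemma ang_turn {D : Dart} (h : D.Valid) (t : Bool) :
    ang D.dir (D.dir + rot t D.dir) + ang (D.dir + rot t D.dir) (rot t D.dir)
      = (if t then 1 else -1) * (Real.pi / 3) := by
  obtain ⟨α, β, h1, h2⟩ := exists_halfPlane_rot h t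
  rw [ang_add α β h1 ?_ h2]
  · cases t
    · rw [ang_rot_false h.dir_ne_zero]; simp
    · rw [ang_rot_true h.dir_ne_zero]; simp
  · simp only [Prod.fst_add, Prod.snd_add]
    linarith

/-- Hopf's theorem on turning tangents, for open polygonal paths: the total turning of a simple
path is the angle by which the line of sight from its first point turns while the endpoint runs
through the path, plus the same for the line of sight from its last point. -/
theorem wind_eq_view {D : Dart} (hD : D.Valid) (L : List Bool)
    (hL : ((run D L).tgt :: (trail D L ++ [D.src])).Nodup) :
    wind L * (Real.pi / 3) = view D.src ((run D L).tgt :: trail D L)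
      + view (run D L).tgt (trail D L ++ [D.src]) := by
  induction L with
  | nil => simp
  | cons t L ih =>
    rw [trail_cons, List.cons_append, List.nodup_cons] at hL
    have ih := ih hL.2
    set E := run D L with hE
    have hEv : E.Valid := valid_run hD L
    obtain ⟨l, hl⟩ := trail_append_src_eq D L
    have hlast : (E.src :: l).getLast (List.cons_ne_nil _ _) = D.src := by
      simp only [hE, ← hl]; simp
    have hch := isChain_verts hD L
    have hnd := hL.2
    have hu := hL.1
    rw [hl] at ih hch hnd hu
    rw [List.nodup_cons] at hnd
    have hu2 : (run D (t :: L)).tgt ∉ E.src :: l := fun h => hu (List.mem_cons_of_mem _ h)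
    have hmove := view_move E.src l
      (isChain_sep (valid_run hD (t :: L)).adj (List.isChain_cons_cons.1 hch |>.2) hnd.1 hu2)
    rw [hlast] at hmove
    simp only [run_cons, Dart.step_src] at hmove
    rw [trail_cons, List.cons_append, hl, wind_cons, run_cons, view_cons_cons, view_cons_cons,
      hmove]
    have hturn := ang_turn hEv t
    have e1 : ang (E.src - E.tgt) (E.src - (E.step t).tgt)
        = ang E.dir (E.dir + rot t E.dir) := by
      rw [ang_sub_comm]
      congr 1 <;> simp [Dart.tgt]
      abel
    have e2 : ang (E.src - (E.step t).tgt) (E.tgt - (E.step t).tgt)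
        = ang (E.dir + rot t E.dir) (rot t E.dir) := by
      rw [ang_sub_comm]
      congr 1 <;> simp [Dart.tgt]
      abel
    have e3 := ang_sub_comm D.src E.tgt D.src (E.step t).tgt
    rw [e1, e2, e3]
    push_cast
    split_ifs at hturn ⊢ with ht <;> linarith

/-- A point of view that moves along a path disjoint from a closed path sees the closed path
under a constant angle. -/
lemma view_closed (q : Pt) (c : List Pt) (hc : (q :: c).IsChain Adj)
    (hcl : (q :: c).getLast (List.cons_ne_nil _ _) = q) (z : Pt) (l : List Pt)
    (hl : (z :: l).IsChain Adj) (hd : ∀ p ∈ z :: l, p ∉ q :: c) :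
    view z (q :: c) = view ((z :: l).getLast (List.cons_ne_nil _ _)) (q :: c) := by
  induction l generalizing z with
  | nil => rfl
  | cons z' l ih =>
    rw [List.isChain_cons_cons] at hl
    rw [List.getLast_cons (List.cons_ne_nil _ _),
      ← ih z' hl.2 fun p hp => hd p (List.mem_cons_of_mem _ hp)]
    have := view_move (z := z) (z' := z') q c
      (isChain_sep hl.1 hc (hd z (by simp)) (hd z' (by simp)))
    rw [hcl] at this
    linarith

/-- A loop of a self-avoiding walk: after the turns `L₁` the walk reaches a vertex `v` and turns left
there; after the further turns `L₂` it comes back to `v`, from the right.  If the walk started in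
a half-plane that it never left, then the loop is run through clockwise. -/
theorem wind_loop {D : Dart} (hD : D.Valid) (L₁ L₂ : List Bool)
    (hend : (run D (L₂ ++ true :: L₁)).rev = (run D L₁).step false)
    (hnd : (trail D (L₂ ++ true :: L₁) ++ [D.src]).Nodup)
    (α β : ℤ) (hpos : ∀ p ∈ trail D (L₂ ++ true :: L₁),
      0 < α * (p - D.src).1 + β * (p - D.src).2) :
    wind L₂ = -5 := by
  set E := run D L₁ with hE
  have hEv : E.Valid := valid_run hD L₁
  obtain ⟨y, hy⟩ : ∃ y, y = E.src := ⟨_, rfl⟩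
  obtain ⟨v, hv⟩ : ∃ v, v = E.tgt := ⟨_, rfl⟩
  obtain ⟨d, hd⟩ : ∃ d, d = E.dir := ⟨_, rfl⟩
  have hd0 : d ≠ 0 := hd ▸ hEv.dir_ne_zero
  set G := E.step true with hG
  have hGv : G.Valid := hEv.step true
  have hGs : G.src = v := hv.symm
  have hrun : run D (L₂ ++ true :: L₁) = run G L₂ := by rw [run_append]; rfl
  have htrail : trail D (L₂ ++ true :: L₁) = trail G L₂ ++ v :: trail D L₁ := by
    rw [trail_append, hv]; rfl
  rw [hrun] at hend
  rw [htrail] at hnd hpos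
  have hHtgt : (run G L₂).tgt = v := by
    have := congrArg Dart.src hend
    simpa [hv] using this
  have hHdir : (run G L₂).dir = -rot false d := by
    have := congrArg Dart.dir hend
    simp only [Dart.rev_dir, Dart.step_dir, ← hd] at this
    rw [← this, neg_neg]
  have hHsrc : (run G L₂).src = v + rot false d := by
    have := (run G L₂).tgt_sub_src
    rw [hHtgt, hHdir] at this
    rw [← sub_eq_iff_eq_add', ← neg_sub, this, neg_neg]
  have hrot : rot false d ≠ rot true d := by
    rcases hEv.dir_cases with h | h | h | h | h | h <;> rw [hd, h] <;> decide
  -- the loop has at least two vertices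
  match L₂, hrun, htrail, hend, hnd, hpos, hHtgt, hHdir, hHsrc with
  | [], _, _, _, _, _, hHtgt, hHdir, hHsrc =>
    exfalso
    have h0 : rot false d = 0 := by simpa [hGs] using hHsrc.symm
    rcases hEv.dir_cases with h | h | h | h | h | h <;> rw [hd, h] at h0 <;> revert h0 <;> decide
  | [s], _, _, _, _, _, hHtgt, hHdir, hHsrc =>
    exfalso
    have h0 : G.tgt = v + rot false d := hHsrc
    rw [Dart.tgt, hGs] at h0
    have h1 : G.dir = rot true d := by rw [hd]; rfl
    rw [h1] at h0
    exact hrot (add_left_cancel h0).symm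
  | s :: s' :: L₂, hrun, htrail, hend, hnd, hpos, hHtgt, hHdir, hHsrc =>
  obtain ⟨q, hq⟩ : ∃ q, q = (run G (s' :: L₂)).tgt := ⟨_, rfl⟩
  obtain ⟨r, hr⟩ : ∃ r, r = (run G L₂).tgt := ⟨_, rfl⟩
  obtain ⟨a, ha⟩ : ∃ a, a = G.tgt := ⟨_, rfl⟩
  obtain ⟨ρ, hρ⟩ : ∃ ρ, ρ = trail G L₂ := ⟨_, rfl⟩
  have hq' : q = v + rot false d := by rw [← hHsrc, hq]; rfl
  have ha' : a = v + rot true d := by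
    rw [ha, Dart.tgt, hGs, hd]; rfl
  have hvy : v = y + d := by rw [hv, hy, hd]; rfl
  have hloop : trail G (s :: s' :: L₂) = q :: r :: ρ := by
    rw [trail_cons, trail_cons, hq, hr, hρ]
  have hlast : (r :: ρ).getLast (List.cons_ne_nil _ _) = a := by
    simp only [hr, hρ, ha]; exact getLast_tgt_trail G L₂
  rw [hloop] at hnd hpos
  -- adjacency along the loop and along the tail
  have hch := isChain_verts hGv (s :: s' :: L₂)
  rw [hHtgt, hloop, hGs] at hch
  obtain ⟨τ, hτ⟩ := trail_append_src_eq D L₁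
  rw [← hE, ← hy] at hτ
  have hlastτ : (y :: τ).getLast (List.cons_ne_nil _ _) = D.src := by
    simp only [← hτ]; simp
  have hnd' : ((q :: r :: ρ) ++ v :: (y :: τ)).Nodup := by
    rw [← hτ]; simpa using hnd
  have hchτ : (v :: y :: τ).IsChain Adj := by
    have := isChain_verts hD L₁
    rwa [hτ, ← hE, ← hv] at this
  obtain ⟨hn1, hn2, hn3⟩ := List.nodup_append.1 hnd'
  replace hn1 := List.nodup_cons.1 hn1
  replace hn2 := (List.nodup_cons.1 hn2).1
  have hdis : ∀ p ∈ y :: τ, p ∉ v :: ((q :: r :: ρ) ++ [v]) := by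
    intro p hp hp'
    have h1 : p = v ∨ p ∈ q :: r :: ρ := by
      simp only [List.mem_cons, List.mem_append, List.not_mem_nil, or_false] at hp' ⊢
      tauto
    rcases h1 with h1 | h1
    · exact hn2 (h1 ▸ hp)
    · exact hn3 p h1 p (List.mem_cons_of_mem _ hp) rfl
  -- the tail sees the whole loop under the angle `0`, as this is so for its first point
  have hzero : view y (v :: ((q :: r :: ρ) ++ [v])) = 0 := by
    rw [view_closed v _ hch (by simp) y τ (List.isChain_cons_cons.1 hchτ).2 hdis, hlastτ,
      view_of_halfPlane α β]
    · rw [List.getLast_cons (by simp), List.getLast_append_of_ne_nil _ (by simp),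
        List.getLast_singleton, ang_self]
      intro h0
      have := hpos v (by simp)
      rw [h0] at this
      simp at this
    · intro p hp
      apply hpos
      simp only [List.mem_cons, List.mem_append, List.not_mem_nil, or_false] at hp ⊢
      tauto
  rw [List.cons_append, view_cons_cons, ← List.cons_append, view_append_singleton,
    List.getLast_cons (List.cons_ne_nil _ _), hlast] at hzero
  have hchl : (q :: r :: ρ).IsChain Adj := by
    rw [List.cons_append, List.isChain_cons_cons, ← List.cons_append] at hch
    exact hch.2.left_of_append
  have hvq : Adj v q := by
    rw [List.cons_append, List.isChain_cons_cons] at hch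
    exact hch.1
  have hyl : y ∉ q :: r :: ρ := fun h => hn3 y h y (by simp) rfl
  have hvl : v ∉ q :: r :: ρ := fun h => hn3 v h v (by simp) rfl
  -- moving the point of view from `y` to `v`, and from `q` to `v`
  have hmove1 := view_move (z := y) (z' := v) q (r :: ρ)
    (isChain_sep (List.isChain_cons_cons.1 hchτ).1.symm hchl hyl hvl)
  rw [List.getLast_cons (List.cons_ne_nil _ _), hlast] at hmove1
  have hmove2 := view_move (z := q) (z' := v) r ρ
    (isChain_sep hvq.symm (List.isChain_cons_cons.1 hchl).2 hn1.1
      fun h => hvl (List.mem_cons_of_mem _ h))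
  rw [hlast] at hmove2
  -- the total turning up to the last edge of the loop
  have hhopf := wind_eq_view hGv (s' :: L₂) (by
    rw [← hq, trail_cons, ← hr, ← hρ, hGs, ← List.cons_append, List.nodup_append]
    refine ⟨List.nodup_cons.2 hn1, by simp, fun p hp p' hp' hpp => ?_⟩
    rw [List.mem_singleton] at hp'
    exact hvl (by rw [← hp', ← hpp]; exact hp))
  rw [← hq, trail_cons, ← hr, ← hρ, hGs, view_append_singleton, hlast] at hhopf
  -- the turn at `q`
  have hKv : (run G (s' :: L₂)).Valid := valid_run hGv _
  have hturn := ang_turn hKv s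
  have hKdir : (run G (s' :: L₂)).dir = q - r := by
    rw [hq, Dart.tgt, run_cons, Dart.step_src, ← hr]; abel
  have hKrot : rot s (run G (s' :: L₂)).dir = v - q := by
    have : (run G (s :: s' :: L₂)).dir = v - q := by rw [hHdir, hq']; abel
    rw [← this]; rfl
  rw [hKrot, hKdir, show q - r + (v - q) = v - r by abel] at hturn
  rw [wind_cons]
  have hview : view v (q :: r :: ρ) = ang (r - v) (q - v) + view v (r :: ρ) := rfl
  -- the remaining angles are angles in the neighbourhood of `v`
  have k1 : ang (v - y) (a - y) + ang (a - y) (a - v) = Real.pi / 3 := by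
    have := ang_turn hEv true
    rw [← hd] at this
    simp only [if_true, one_mul] at this
    rw [show v - y = d by rw [hvy]; abel, show a - y = d + rot true d by rw [ha', hvy]; abel,
      show a - v = rot true d by rw [ha']; abel, this]
  have k2 : ang (q - y) (q - v) - ang (q - y) (v - y) = -(Real.pi / 3) := by
    have h1 := ang_turn hEv false
    have h2 := hEv.dir_cases
    rw [← hd] at h1 h2
    rw [show v - y = d by rw [hvy]; abel, show q - y = d + rot false d by rw [hq', hvy]; abel,
      show q - v = rot false d by rw [hq']; abel]
    obtain ⟨α, β, h3, h4⟩ := exists_halfPlane_rot hEv false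
    rw [← hd] at h3 h4
    have h5 : 0 < α * (d + rot false d).1 + β * (d + rot false d).2 := by
      simp only [Prod.fst_add, Prod.snd_add]; linarith
    have h6 := ang_add α β h5 h3 h4
    have h7 := ang_rot_false hd0
    linarith
  have k3 : ang (v - q) (a - q) + ang (a - q) (a - v) = -(Real.pi / 3) := by
    have e1 : v - q = -rot false d := by rw [hq']; abel
    have e2 : a - v = rot true d := by rw [ha']; abel
    have e3 : a - q = -rot false d + rot true d := by rw [ha', hq']; abel
    have e4 : rot true d = rot false (-rot false d) := by
      simp
    rw [e1, e2, e3]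
    have hHv : (run G (s :: s' :: L₂)).Valid := valid_run hGv _
    have := ang_turn hHv false
    rw [hHdir, ← e4] at this
    simpa using this
  have hfin : (((if s then 1 else -1) + wind (s' :: L₂) : ℤ) : ℝ) * (Real.pi / 3)
      = -5 * (Real.pi / 3) := by
    have h1 := ang_sub_comm q r v r
    have h2 := ang_sub_comm v r v q
    have h3 := ang_sub_comm q r q v
    push_cast at hhopf ⊢
    rw [add_mul]
    rw [hhopf]
    have h4 : ((if s then (1 : ℝ) else -1)) * (Real.pi / 3) =
      ang (r - q) (r - v) + ang (r - v) (q - v) := by rw [← hturn, h1, h2]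
    rw [h4]
    linarith
  have := mul_right_cancel₀ (by positivity) hfin
  exact_mod_cast this

/-- A simple path that starts and ends on the boundary of a convex set turns by at most `π` in
total.  Here `(α₀, β₀)` and `(α₁, β₁)` describe half-planes that contain the path as seen from its
first point, and, reversed, as seen from its last point. -/
theorem abs_wind_le {D : Dart} (hD : D.Valid) (L : List Bool)
    (hnd : ((run D L).tgt :: (trail D L ++ [D.src])).Nodup) (α₀ β₀ α₁ β₁ : ℤ)
    (h0 : ∀ p ∈ (run D L).tgt :: trail D L, 0 < α₀ * (p - D.src).1 + β₀ * (p - D.src).2)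
    (h1 : ∀ p ∈ trail D L ++ [D.src],
      0 < α₁ * (p - (run D L).tgt).1 + β₁ * (p - (run D L).tgt).2)
    (hr0 : 0 ≤ (toC ((run D L).tgt - D.src) / toC D.dir).re)
    (hr1 : 0 ≤ (toC (run D L).dir / toC ((run D L).tgt - D.src)).re) :
    |wind L| ≤ 3 := by
  have hw := wind_eq_view hD L hnd
  obtain ⟨l, hl⟩ := trail_append_src_eq D L
  have hlast : ((run D L).src :: l).getLast (List.cons_ne_nil _ _) = D.src := by
    simp only [← hl]; simp
  rw [view_of_halfPlane α₀ β₀ _ _ h0, getLast_tgt_trail, hl,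
    view_of_halfPlane α₁ β₁ _ _ (hl ▸ h1), hlast, ang_sub_comm (D.src), Dart.tgt_sub_src,
    Dart.tgt_sub_src] at hw
  have e0 := Complex.abs_arg_le_pi_div_two_iff.2 hr0
  have e1 := Complex.abs_arg_le_pi_div_two_iff.2 hr1
  rw [abs_le] at e0 e1
  unfold ang at hw
  have hpi := Real.pi_pos
  have h3 : (wind L : ℝ) ≤ 3 := by nlinarith
  have h4 : (-3 : ℝ) ≤ wind L := by nlinarith
  rw [abs_le]
  exact ⟨by exact_mod_cast h4, by exact_mod_cast h3⟩

/-! ### The parafermionic observable -/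

/-- The directed edge through the origin: from its left end, which is taken as the point `0` of the
grid, to its right end. -/
def start : Dart := ⟨0, (1, 0)⟩

lemma start_valid : start.Valid := Or.inl ⟨by simp [start], Or.inl rfl⟩

@[simp] lemma start_src : start.src = 0 := rfl
@[simp] lemma start_dir : start.dir = (1, 0) := rfl
@[simp] lemma start_tgt : start.tgt = (1, 0) := rfl

/-- The walk with turns `L` from the origin is self-avoiding and turns at vertices of `Ω` only.  Its
last vertex, the target of its last edge, is left unconstrained. -/
def Admissible (Ω : Set Pt) (L : List Bool) : Prop :=
  (trail start L).Nodup ∧ ∀ p ∈ trail start L, p ∈ Ω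

/-- The walk with turns `L` from the origin is self-avoiding, stays in `Ω`, and leaves `Ω` with its
last edge. -/
def Exits (Ω : Set Pt) (L : List Bool) : Prop := Admissible Ω L ∧ (run start L).tgt ∉ Ω

lemma admissible_nil (Ω : Set Pt) : Admissible Ω [] := ⟨List.nodup_nil, by simp⟩

lemma admissible_cons {Ω : Set Pt} {t : Bool} {L : List Bool} : Admissible Ω (t :: L) ↔
    Admissible Ω L ∧ (run start L).tgt ∈ Ω ∧ (run start L).tgt ∉ trail start L := by
  simp only [Admissible, trail_cons, List.nodup_cons, List.mem_cons, forall_eq_or_imp]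
  tauto

lemma Admissible.mono {Ω Ω' : Set Pt} {L : List Bool} (h : Admissible Ω L) (hs : Ω ⊆ Ω') :
    Admissible Ω' L := ⟨h.1, fun p hp => hs (h.2 p hp)⟩

lemma finite_admissible {Ω : Set Pt} (hΩ : Ω.Finite) : {L | Admissible Ω L}.Finite := by
  refine (List.finite_length_le Bool hΩ.toFinset.card).subset fun L hL => ?_
  have h1 : (trail start L).toFinset ⊆ hΩ.toFinset := fun p hp => by
    rw [Set.Finite.mem_toFinset]
    exact hL.2 p (List.mem_toFinset.1 hp)
  have h2 := Finset.card_le_card h1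
  rwa [List.toFinset_card_of_nodup hL.1, length_trail] at h2

lemma mem_trail_iff {D : Dart} {L : List Bool} {v : Pt} :
    v ∈ trail D L ↔ ∃ L₁ t L₂, L = L₂ ++ t :: L₁ ∧ (run D L₁).tgt = v := by
  induction L with
  | nil => simp
  | cons s L ih =>
    rw [trail_cons, List.mem_cons, ih]
    constructor
    · rintro (h | ⟨L₁, t, L₂, h, h'⟩)
      · exact ⟨L, s, [], rfl, h.symm⟩
      · exact ⟨L₁, t, s :: L₂, by rw [h]; rfl, h'⟩
    · rintro ⟨L₁, t, L₂, h, h'⟩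
      cases L₂ with
      | nil =>
        simp only [List.nil_append, List.cons.injEq] at h
        exact Or.inl (by rw [h.2, h'])
      | cons s' L₂ =>
        simp only [List.cons_append, List.cons.injEq] at h
        exact Or.inr ⟨L₁, t, L₂, h.2, h'⟩

lemma split_unique {D : Dart} {L₁ L₁' L₂ L₂' : List Bool} {t t' : Bool}
    (h : L₂ ++ t :: L₁ = L₂' ++ t' :: L₁') (hnd : (trail D (L₂ ++ t :: L₁)).Nodup)
    (hv : (run D L₁).tgt = (run D L₁').tgt) : L₁ = L₁' ∧ t = t' ∧ L₂ = L₂' := by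
  have aux : ∀ {M₁ M₁' M₂ M₂' a : List Bool} {s s' : Bool}, (trail D (M₂ ++ s :: M₁)).Nodup →
      (run D M₁).tgt = (run D M₁').tgt → M₂' = M₂ ++ a → s :: M₁ = a ++ s' :: M₁' → a = [] := by
    intro M₁ M₁' M₂ M₂' a s s' hnd hv _ ha
    cases a with
    | nil => rfl
    | cons b a =>
      exfalso
      simp only [List.cons_append, List.cons.injEq] at ha
      have h1 : (run D M₁').tgt ∈ trail D M₁ := mem_trail_iff.2 ⟨_, _, _, ha.2, rfl⟩
      rw [trail_append, trail_cons] at hnd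
      have h2 := (List.nodup_cons.1 (List.nodup_append.1 hnd).2.1).1
      exact h2 (hv ▸ h1)
  rcases List.append_eq_append_iff.1 h with ⟨a, h1, h2⟩ | ⟨a, h1, h2⟩
  · obtain rfl := aux hnd hv h1 h2
    simp_all
  · obtain rfl := aux (h ▸ hnd) hv.symm h1 h2
    simp_all

lemma eq_or_rev_eq_step {D E : Dart} (hD : D.Valid) (hE : E.Valid) (h : D.tgt = E.tgt) :
    D = E ∨ D.rev = E.step true ∨ D.rev = E.step false := by
  obtain ⟨⟨a, b⟩, ⟨c, d⟩⟩ := D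
  obtain ⟨⟨a', b'⟩, ⟨c', d'⟩⟩ := E
  simp only [Dart.Valid, Dart.tgt, IsStep, Dart.rev, Dart.step, Dart.mk.injEq, Prod.mk.injEq,
    Prod.mk_add_mk, Prod.neg_mk, rot_true, rot_false] at *
  omega

/-- A self-avoiding walk that comes back to a vertex `v` at which it made the turn `t` arrives along
the third edge of `v`. -/
lemma rev_run_loop {D : Dart} (hD : D.Valid) {L₁ L₂ : List Bool} {t : Bool}
    (hv : (run D L₁).tgt = (run D (L₂ ++ t :: L₁)).tgt)
    (hnd : (trail D (L₂ ++ t :: L₁) ++ [D.src]).Nodup) :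
    (run D (L₂ ++ t :: L₁)).rev = (run D L₁).step (!t) := by
  set E := run D L₁ with hE
  have hEv : E.Valid := valid_run hD L₁
  have hGv : (E.step t).Valid := hEv.step t
  have hrun : run D (L₂ ++ t :: L₁) = run (E.step t) L₂ := by rw [run_append]; rfl
  have htrail : trail D (L₂ ++ t :: L₁) = trail (E.step t) L₂ ++ E.tgt :: trail D L₁ := by
    rw [trail_append]; rfl
  rw [hrun] at hv ⊢
  rw [htrail] at hnd
  have h1 : run (E.step t) L₂ ≠ E := by
    intro h
    cases L₂ with
    | nil =>
      have := hGv.dir_ne_zero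
      rw [run_nil] at hv
      rw [Dart.tgt, Dart.tgt, Dart.step_src] at hv
      exact this (by simpa [Dart.tgt] using hv)
    | cons s L₂ =>
      rw [List.append_assoc, List.nodup_append, trail_eq_src_cons, h] at hnd
      refine hnd.2.2 E.src (by simp) E.src ?_ rfl
      rw [List.cons_append]
      exact List.mem_cons_of_mem _ (src_mem_trail_append D L₁)
  have h2 : (run (E.step t) L₂).rev ≠ E.step t := by
    intro h
    match L₂, hnd, h with
    | [], _, h =>
      have h3 := congrArg Dart.dir h
      simp only [run_nil, Dart.rev_dir] at h3
      exact hGv.dir_ne_zero (self_eq_neg.1 h3.symm)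
    | [s], _, h =>
      have h3 := congrArg Dart.dir h
      simp only [run_nil, run_cons, Dart.rev_dir, Dart.step_dir] at h3
      rcases hEv.dir_cases with h | h | h | h | h | h <;> rw [h] at h3 <;> revert h3 <;>
        cases s <;> cases t <;> decide
    | s :: s' :: L₂, hnd, h =>
      have h3 : (run (E.step t) (s' :: L₂)).tgt = (E.step t).tgt := by
        have h3 := congrArg Dart.tgt h
        rwa [Dart.rev_tgt] at h3
      have h4 : (E.step t).tgt ∈ trail (E.step t) (s' :: L₂) := by
        have := getLast_tgt_trail (E.step t) L₂
        rw [← this]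
        exact List.getLast_mem _
      have h5 := (List.nodup_append.1 (List.nodup_append.1 hnd).1).1
      rw [trail_cons, List.nodup_cons, h3] at h5
      exact h5.1 h4
  have h3 := eq_or_rev_eq_step (valid_run hGv L₂) hEv hv.symm
  cases t <;> simp_all

/-! ### The weights -/

/-- The eighth root of `-1` by which the phase of the observable changes at a left turn. -/
noncomputable def zeta : ℂ := Complex.exp (((Real.pi / 8 : ℝ) : ℂ) * Complex.I)

lemma zeta_ne_zero : zeta ≠ 0 := Complex.exp_ne_zero _

lemma zeta_zpow_re (n : ℤ) : (zeta ^ n).re = Real.cos (n * (Real.pi / 8)) := by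
  rw [zeta, ← Complex.exp_int_mul, ← mul_assoc]
  have : ((n : ℂ) * ((Real.pi / 8 : ℝ) : ℂ)) = ((n * (Real.pi / 8) : ℝ) : ℂ) := by push_cast; ring
  rw [this, Complex.exp_ofReal_mul_I_re]

lemma zeta_pow_four : zeta ^ (4 : ℤ) + zeta ^ (-4 : ℤ) = 0 := by
  have h : zeta ^ (8 : ℤ) = -1 := by
    rw [zeta, ← Complex.exp_int_mul, ← Complex.exp_pi_mul_I]
    congr 1
    push_cast
    ring
  have h2 : zeta ^ (4 : ℤ) = zeta ^ (8 : ℤ) * zeta ^ (-4 : ℤ) := by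
    rw [← zpow_add₀ zeta_ne_zero]; norm_num
  rw [h2, h]
  ring

lemma hexCriticalWeight_pos : 0 < hexCriticalWeight := by
  unfold hexCriticalWeight; positivity

lemma two_mul_cos_mul_hexCriticalWeight : 2 * Real.cos (Real.pi / 8) * hexCriticalWeight = 1 := by
  rw [Real.cos_pi_div_eight, hexCriticalWeight]
  have : 0 < √(2 + √2) := by positivity
  field_simp

lemma hexCriticalWeight_mul_zeta :
    (hexCriticalWeight : ℂ) * (zeta + zeta⁻¹) = 1 := by
  have h : zeta + zeta⁻¹ = ((2 * Real.cos (Real.pi / 8) : ℝ) : ℂ) := by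
    rw [zeta, ← Complex.exp_neg]
    push_cast
    rw [Complex.two_cos]
    ring_nf
  rw [h, ← Complex.ofReal_mul, mul_comm, two_mul_cos_mul_hexCriticalWeight, Complex.ofReal_one]

/-- The weight of a walk in the parafermionic observable of spin `5/8`, multiplied by the direction of
its last edge: every vertex contributes the critical weight and the phase
`exp(± i (1 - 5/8) π/3) = exp(± iπ/8)`. -/
noncomputable def weight (L : List Bool) : ℂ := hexCriticalWeight ^ L.length * zeta ^ wind L

lemma weight_extend (L : List Bool) : weight (true :: L) + weight (false :: L) = weight L := by
  simp only [weight, wind_cons, List.length_cons]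
  rw [zpow_add₀ zeta_ne_zero, zpow_add₀ zeta_ne_zero]
  simp only [if_true, Bool.false_eq_true, if_false, zpow_one, zpow_neg]
  linear_combination (hexCriticalWeight ^ L.length * zeta ^ wind L : ℂ) * hexCriticalWeight_mul_zeta

lemma weight_re (L : List Bool) :
    (weight L).re = hexCriticalWeight ^ L.length * Real.cos (wind L * (Real.pi / 8)) := by
  rw [weight, ← Complex.ofReal_pow, Complex.re_ofReal_mul, zeta_zpow_re]

/-- Loops cancel: the two directions in which a loop can be run through have opposite weights. -/
lemma weight_loop {L₁ L₂ : List Bool} (t : Bool)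
    (hv : (run start L₁).tgt = (run start (L₂ ++ t :: L₁)).tgt)
    (hnd : (trail start (L₂ ++ t :: L₁) ++ [start.src]).Nodup)
    (α β : ℤ) (hpos : ∀ p ∈ trail start (L₂ ++ t :: L₁),
      0 < α * (p - start.src).1 + β * (p - start.src).2) :
    weight (L₂ ++ t :: L₁) + weight (revTurns L₂ ++ (!t) :: L₁) = 0 := by
  have hrev := rev_run_loop start_valid hv hnd
  have hw : (if t then 1 else -1) + wind L₂ = if t then -4 else 4 := by
    cases t with
    | true =>
      have := wind_loop start_valid L₁ L₂ hrev hnd α β hpos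
      simp [this]
    | false =>
      have h1 : run start (L₂ ++ false :: L₁) = run ((run start L₁).step false) L₂ := by
        rw [run_append]; rfl
      have h2 : trail start (revTurns L₂ ++ true :: L₁) =
          (trail ((run start L₁).step false) L₂).reverse ++
            ((run start L₁).tgt :: trail start L₁) := by
        rw [trail_append, ← trail_revTurns, ← h1, hrev]; rfl
      have h3 : trail start (L₂ ++ false :: L₁) =
          trail ((run start L₁).step false) L₂ ++ ((run start L₁).tgt :: trail start L₁) := by
        rw [trail_append]; rfl
      have hp : (trail start (revTurns L₂ ++ true :: L₁)).Perm
          (trail start (L₂ ++ false :: L₁)) := by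
        rw [h2, h3]
        exact (List.reverse_perm _).append_right _
      have h4 : run start (revTurns L₂ ++ true :: L₁) = ((run start L₁).step false).rev := by
        rw [run_append, run_cons, ← Bool.not_false, ← hrev, h1, run_revTurns]
      have := wind_loop start_valid L₁ (revTurns L₂) (by rw [h4, Dart.rev_rev])
        ((hp.append_right _).nodup_iff.2 hnd) α β fun p h => hpos p (hp.mem_iff.1 h)
      rw [wind_revTurns] at this
      have : wind L₂ = 5 := by omega
      simp [this]
  have e1 : weight (L₂ ++ t :: L₁) = hexCriticalWeight ^ (L₂ ++ t :: L₁).length *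
      (zeta ^ wind L₁ * zeta ^ (if t then -4 else 4 : ℤ)) := by
    rw [weight, ← zpow_add₀ zeta_ne_zero, wind_append, wind_cons, ← hw]
    congr 2
    ring
  have e2 : weight (revTurns L₂ ++ (!t) :: L₁) = hexCriticalWeight ^ (L₂ ++ t :: L₁).length *
      (zeta ^ wind L₁ * zeta ^ (if t then 4 else -4 : ℤ)) := by
    have : (if t then 4 else -4 : ℤ) = -((if t then 1 else -1) + wind L₂) := by
      rw [hw]; cases t <;> simp
    rw [weight, ← zpow_add₀ zeta_ne_zero, wind_append, wind_cons, wind_revTurns, this,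
      List.length_append, List.length_append, length_revTurns, List.length_cons, List.length_cons]
    congr 2
    cases t <;> simp <;> ring
  rw [e1, e2]
  have := zeta_pow_four
  cases t
  · simp only [Bool.false_eq_true, if_false]
    linear_combination (hexCriticalWeight ^ (L₂ ++ false :: L₁).length * zeta ^ wind L₁ : ℂ) * this
  · simp only [if_true]
    linear_combination (hexCriticalWeight ^ (L₂ ++ true :: L₁).length * zeta ^ wind L₁ : ℂ) * this

/-- The walks that come back to a vertex visited before contribute nothing to the observable. -/
lemma sum_weight_loops {Ω : Set Pt} (h0 : (0 : Pt) ∉ Ω) (α β : ℤ)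
    (hpos : ∀ p ∈ Ω, 0 < α * p.1 + β * p.2) (S : Finset (List Bool))
    (hS : ∀ L, L ∈ S ↔ Admissible Ω L ∧ (run start L).tgt ∈ trail start L) :
    ∑ L ∈ S, weight L = 0 := by
  classical
  have hfin : ∃ n, ∀ L ∈ S, L.length ≤ n := ⟨S.sup List.length, fun L hL => Finset.le_sup hL⟩
  obtain ⟨n, hn⟩ := hfin
  -- a walk with a loop is a triple: the walk up to the loop, the turn there, the rest of the loop
  let B : Finset (List Bool) := (List.finite_length_le Bool n).toFinset
  let T : Finset (List Bool × Bool × List Bool) :=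
    (B ×ˢ (Finset.univ ×ˢ B)).filter fun x => x.2.2 ++ x.2.1 :: x.1 ∈ S ∧
      (run start x.1).tgt = (run start (x.2.2 ++ x.2.1 :: x.1)).tgt
  have hB : ∀ L, L ∈ B ↔ L.length ≤ n := fun L => by simp [B]
  have hT : ∀ L₁ t L₂, (L₁, t, L₂) ∈ T ↔ L₂ ++ t :: L₁ ∈ S ∧
      (run start L₁).tgt = (run start (L₂ ++ t :: L₁)).tgt := by
    intro L₁ t L₂
    simp only [T, Finset.mem_filter, Finset.mem_product, Finset.mem_univ, true_and, hB,
      and_iff_right_iff_imp]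
    rintro ⟨h, -⟩
    have := hn _ h
    simp only [List.length_append, List.length_cons] at this
    omega
  have hsrc : ∀ L, Admissible Ω L → (trail start L ++ [start.src]).Nodup := by
    intro L hL
    rw [List.nodup_append]
    refine ⟨hL.1, by simp, fun p hp q hq hpq => h0 ?_⟩
    rw [List.mem_singleton] at hq
    rw [hpq, hq] at hp
    exact hL.2 _ hp
  have hsum : ∑ x ∈ T, weight (x.2.2 ++ x.2.1 :: x.1) = ∑ L ∈ S, weight L := by
    refine Finset.sum_bij (fun x _ => x.2.2 ++ x.2.1 :: x.1) ?_ ?_ ?_ fun _ _ => rfl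
    · rintro ⟨L₁, t, L₂⟩ hx
      exact ((hT _ _ _).1 hx).1
    · rintro ⟨L₁, t, L₂⟩ hx ⟨L₁', t', L₂'⟩ hx' h
      have h1 := (hT _ _ _).1 hx
      have h2 := (hT _ _ _).1 hx'
      simp only at h
      obtain ⟨rfl, rfl, rfl⟩ := split_unique (D := start) h ((hS _).1 h1.1).1.1
        (by rw [h1.2, h2.2, h])
      rfl
    · intro L hL
      obtain ⟨L₁, t, L₂, h1, h2⟩ := mem_trail_iff.1 ((hS L).1 hL).2
      exact ⟨(L₁, t, L₂), (hT _ _ _).2 ⟨h1 ▸ hL, h1 ▸ h2⟩, h1.symm⟩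
  rw [← hsum]
  refine Finset.sum_involution (fun x _ => (x.1, !x.2.1, revTurns x.2.2)) ?_ ?_ ?_ ?_
  · rintro ⟨L₁, t, L₂⟩ hx
    obtain ⟨h1, h2⟩ := (hT _ _ _).1 hx
    have h3 := ((hS _).1 h1).1
    exact weight_loop t h2 (hsrc _ h3) α β fun p hp => by simpa using hpos p (h3.2 p hp)
  · rintro ⟨L₁, t, L₂⟩ - - h
    simp at h
  · rintro ⟨L₁, t, L₂⟩ hx
    obtain ⟨h1, h2⟩ := (hT _ _ _).1 hx
    have h3 := ((hS _).1 h1).1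
    have hrev := rev_run_loop start_valid h2 (hsrc _ h3)
    have e1 : run start (L₂ ++ t :: L₁) = run ((run start L₁).step t) L₂ := by
      rw [run_append]; rfl
    have e2 : trail start (revTurns L₂ ++ (!t) :: L₁) =
        (trail ((run start L₁).step t) L₂).reverse ++
          ((run start L₁).tgt :: trail start L₁) := by
      rw [trail_append, ← trail_revTurns, ← e1, hrev]; rfl
    have e3 : trail start (L₂ ++ t :: L₁) =
        trail ((run start L₁).step t) L₂ ++ ((run start L₁).tgt :: trail start L₁) := by
      rw [trail_append]; rfl
    have e4 : run start (revTurns L₂ ++ (!t) :: L₁) = ((run start L₁).step t).rev := by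
      rw [run_append, run_cons, ← hrev, e1, run_revTurns]
    have hp : (trail start (revTurns L₂ ++ (!t) :: L₁)).Perm
        (trail start (L₂ ++ t :: L₁)) := by
      rw [e2, e3]
      exact (List.reverse_perm _).append_right _
    refine (hT _ _ _).2 ⟨(hS _).2 ⟨⟨hp.nodup_iff.2 h3.1, fun p h => h3.2 p (hp.mem_iff.1 h)⟩, ?_⟩,
      ?_⟩
    · rw [e4, e2]; simp
    · rw [e4]; simp
  · rintro ⟨L₁, t, L₂⟩ -
    simp

/-- The sum of the local relations of the parafermionic observable over a finite domain on whose
boundary the origin lies: the total weight of the walks that leave the domain is `1`. -/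
theorem sum_weight_exits {Ω : Set Pt} (hΩ : Ω.Finite) (h0 : (0 : Pt) ∉ Ω)
    (α β : ℤ) (hpos : ∀ p ∈ Ω, 0 < α * p.1 + β * p.2) (S : Finset (List Bool))
    (hS : ∀ L, L ∈ S ↔ Exits Ω L) : ∑ L ∈ S, weight L = 1 := by
  classical
  obtain ⟨A, hA⟩ : ∃ A : Finset (List Bool), ∀ L, L ∈ A ↔ Admissible Ω L :=
    ⟨(finite_admissible hΩ).toFinset, fun L => by simp⟩
  set N := (A.filter fun L => (run start L).tgt ∈ Ω).filter
    fun L => (run start L).tgt ∉ trail start L with hN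
  set X := (A.filter fun L => (run start L).tgt ∈ Ω).filter
    fun L => ¬ (run start L).tgt ∉ trail start L with hX
  have hSA : S = A.filter fun L => ¬ (run start L).tgt ∈ Ω := by
    ext L
    rw [hS, Finset.mem_filter, hA, Exits]
  have hX0 : ∑ L ∈ X, weight L = 0 := by
    refine sum_weight_loops h0 α β hpos X fun L => ?_
    simp only [hX, Finset.mem_filter, hA, not_not]
    exact ⟨fun h => ⟨h.1.1, h.2⟩, fun h => ⟨⟨h.1, h.1.2 _ h.2⟩, h.2⟩⟩
  have e1 : ∑ L ∈ A, weight L = ∑ L ∈ N, weight L + ∑ L ∈ X, weight L + ∑ L ∈ S, weight L := by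
    rw [hSA, ← Finset.sum_filter_add_sum_filter_not A fun L => (run start L).tgt ∈ Ω,
      ← Finset.sum_filter_add_sum_filter_not (A.filter fun L => (run start L).tgt ∈ Ω)
        fun L => (run start L).tgt ∉ trail start L]
  have e2 : ∑ L ∈ A, weight L = weight [] + ∑ L ∈ A.erase [], weight L :=
    (Finset.add_sum_erase A weight ((hA _).2 (admissible_nil Ω))).symm
  have e3 : ∑ L ∈ A.erase [], weight L = ∑ x ∈ N ×ˢ (Finset.univ : Finset Bool),
      weight (x.2 :: x.1) := by
    symm
    refine Finset.sum_bij (fun x _ => x.2 :: x.1) ?_ ?_ ?_ fun _ _ => rfl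
    · rintro ⟨L, t⟩ hx
      simp only [hN, Finset.mem_product, Finset.mem_filter, hA, Finset.mem_univ, and_true] at hx
      rw [Finset.mem_erase, hA, admissible_cons]
      exact ⟨by simp, hx.1.1, hx.1.2, hx.2⟩
    · rintro ⟨L, t⟩ - ⟨L', t'⟩ - h
      simp only [List.cons.injEq] at h
      simp [h]
    · intro L hL
      rw [Finset.mem_erase, hA] at hL
      cases L with
      | nil => exact absurd rfl hL.1
      | cons t L =>
        refine ⟨(L, t), ?_, rfl⟩
        simp only [hN, Finset.mem_product, Finset.mem_filter, hA, Finset.mem_univ, and_true]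
        have := admissible_cons.1 hL.2
        exact ⟨⟨this.1, this.2.1⟩, this.2.2⟩
  have e4 : ∑ x ∈ N ×ˢ (Finset.univ : Finset Bool), weight (x.2 :: x.1) = ∑ L ∈ N, weight L := by
    rw [Finset.sum_product]
    refine Finset.sum_congr rfl fun L _ => ?_
    rw [Fintype.sum_bool]
    exact weight_extend L
  have e5 : weight [] = 1 := by simp [weight]
  rw [e1, e3, e4, e5, hX0] at e2
  linear_combination e2

/-! ### Winding of walks that leave a convex domain -/

/-- The half-plane to the right of the origin. -/
def halfPlane : Set Pt := {p | 1 ≤ 2 * p.1 + p.2}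

/-- The strip that consists of the columns `0, …, T - 1`. -/
def strip (T : ℕ) : Set Pt := {p | 1 ≤ 2 * p.1 + p.2 ∧ 2 * p.1 + p.2 ≤ 3 * (T : ℤ)}

/-- The part of a strip that lies between an upward and a downward sloping line, at the angles `±π/6`
to the horizontal. -/
def trapezoid (T N : ℕ) : Set Pt :=
  {p | p ∈ strip T ∧ p.2 - p.1 ≤ 3 * (N : ℤ) ∧ -p.1 - 2 * p.2 ≤ 3 * (N : ℤ)}

/-- The equilateral triangle of side length `2 s + 1` that has a vertical side on its left, with the
origin as the midpoint of that side. -/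
def triangle (s : ℕ) : Set Pt :=
  {p | 1 ≤ 2 * p.1 + p.2 ∧ p.1 + 2 * p.2 ≤ 3 * (s : ℤ) + 1 ∧ p.1 - p.2 ≤ 3 * (s : ℤ) + 1}

/-- A self-avoiding walk in `Ω` that leaves the half-plane to the right of the origin with its last
edge. -/
def ExitsLeft (Ω : Set Pt) (L : List Bool) : Prop :=
  Admissible Ω L ∧ 2 * (run start L).tgt.1 + (run start L).tgt.2 ≤ 0

/-- A self-avoiding walk in a strip that leaves it through its right side. -/
def ExitsRight (T : ℕ) (L : List Bool) : Prop :=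
  Admissible (strip T) L ∧ 3 * (T : ℤ) < 2 * (run start L).tgt.1 + (run start L).tgt.2

/-- A self-avoiding walk in a triangle that leaves it through its upper side. -/
def ExitsUp (s : ℕ) (L : List Bool) : Prop :=
  Admissible (triangle s) L ∧
    3 * (s : ℤ) + 1 < (run start L).tgt.1 + 2 * (run start L).tgt.2

/-- A self-avoiding walk in a triangle that leaves it through its lower side. -/
def ExitsDown (s : ℕ) (L : List Bool) : Prop :=
  Admissible (triangle s) L ∧ 3 * (s : ℤ) + 1 < (run start L).tgt.1 - (run start L).tgt.2

lemma dir_run_wind (L : List Bool) :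
    (wind L % 6 = 0 ∧ (run start L).dir = (1, 0)) ∨ (wind L % 6 = 1 ∧ (run start L).dir = (0, 1)) ∨
    (wind L % 6 = 2 ∧ (run start L).dir = (-1, 1)) ∨
    (wind L % 6 = 3 ∧ (run start L).dir = (-1, 0)) ∨
    (wind L % 6 = 4 ∧ (run start L).dir = (0, -1)) ∨
    (wind L % 6 = 5 ∧ (run start L).dir = (1, -1)) := by
  induction L with
  | nil => simp
  | cons t L ih =>
    rw [run_cons, Dart.step_dir, wind_cons]
    rcases ih with ⟨h, h'⟩ | ⟨h, h'⟩ | ⟨h, h'⟩ | ⟨h, h'⟩ | ⟨h, h'⟩ | ⟨h, h'⟩ <;> rw [h'] <;>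
      cases t <;> simp <;> omega

lemma re_toC_div_nonneg {z w : Pt} (h : 0 ≤ z.1 * (2 * w.1 + w.2) + z.2 * (w.1 + 2 * w.2)) :
    0 ≤ (toC z / toC w).re := by
  rw [Complex.div_re, ← add_div]
  refine div_nonneg ?_ (Complex.normSq_nonneg _)
  rw [toC_re, toC_re, toC_im, toC_im]
  have h3 := sqrt_three_sq
  have h' : (0 : ℝ) ≤ z.1 * (2 * w.1 + w.2) + z.2 * (w.1 + 2 * w.2) := by exact_mod_cast h
  have : (z.1 + z.2 / 2 : ℝ) * (w.1 + w.2 / 2) + z.2 * (√3 / 2) * (w.2 * (√3 / 2))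
      = (z.1 * (2 * w.1 + w.2) + z.2 * (w.1 + 2 * w.2)) / 2 := by
    linear_combination (z.2 * w.2 / 4 : ℝ) * h3
  rw [this]
  linarith

/-- A walk in the half-plane whose last vertex is strictly extremal in some direction, and is reached
by a step into the half-plane that it points to, has winding at most `π`. -/
lemma abs_wind_le_of_extremal {L : List Bool} (hA : Admissible halfPlane L)
    (ht : 1 ≤ 2 * (run start L).tgt.1 + (run start L).tgt.2) (γ δ : ℤ)
    (hp : ∀ p ∈ trail start L,
      γ * p.1 + δ * p.2 < γ * (run start L).tgt.1 + δ * (run start L).tgt.2)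
    (h0 : 0 < γ * (run start L).tgt.1 + δ * (run start L).tgt.2)
    (hr : 0 ≤ (run start L).dir.1 * (2 * (run start L).tgt.1 + (run start L).tgt.2)
      + (run start L).dir.2 * ((run start L).tgt.1 + 2 * (run start L).tgt.2)) :
    |wind L| ≤ 3 := by
  have hnot : (0 : Pt) ∉ trail start L := fun h => by simpa [halfPlane] using hA.2 _ h
  refine abs_wind_le start_valid L ?_ 2 1 (-γ) (-δ) ?_ ?_ ?_ ?_
  · rw [List.nodup_cons, List.nodup_append]
    refine ⟨?_, hA.1, by simp, ?_⟩
    · rw [List.mem_append, List.mem_singleton]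
      rintro (h | h)
      · exact lt_irrefl _ (hp _ h)
      · rw [h] at h0
        simp at h0
    · intro p hp' q hq hpq
      rw [List.mem_singleton, start_src] at hq
      exact hnot (hq ▸ hpq ▸ hp')
  · intro p hp'
    rw [List.mem_cons] at hp'
    simp only [start_src, sub_zero]
    rcases hp' with rfl | hp'
    · linarith
    · have := hA.2 _ hp'
      simp only [halfPlane, Set.mem_ofPred_eq] at this
      linarith
  · intro p hp'
    rw [List.mem_append, List.mem_singleton] at hp'
    simp only [Prod.fst_sub, Prod.snd_sub]
    rcases hp' with hp' | rfl
    · linarith [hp p hp']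
    · simp only [start_src, Prod.fst_zero, Prod.snd_zero]
      linarith
  · apply re_toC_div_nonneg
    simp only [start_src, sub_zero, start_dir]
    linarith
  · apply re_toC_div_nonneg
    simpa using hr

lemma exists_abs_le (l : List Pt) : ∃ K : ℤ, ∀ p ∈ l, |p.1| ≤ K ∧ |p.2| ≤ K := by
  induction l with
  | nil => exact ⟨0, by simp⟩
  | cons q l ih =>
    obtain ⟨K, hK⟩ := ih
    refine ⟨max K (max |q.1| |q.2|), fun p hp => ?_⟩
    rcases List.mem_cons.1 hp with rfl | hp
    · exact ⟨by simp, by simp⟩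
    · exact ⟨(hK p hp).1.trans (le_max_left _ _), (hK p hp).2.trans (le_max_left _ _)⟩

lemma Admissible.src_mem {Ω : Set Pt} {L : List Bool} (h : Admissible Ω L) (hL : L ≠ []) :
    (run start L).src ∈ Ω := by
  cases L with
  | nil => exact absurd rfl hL
  | cons t L => exact h.2 _ (by simp)

/-- A walk that leaves the half-plane does so by a step straight to the left, away from the
origin. -/
lemma tgt_of_exitsLeft {L : List Bool} (h : ExitsLeft halfPlane L) :
    (run start L).dir = (-1, 0) ∧ 2 * (run start L).tgt.1 + (run start L).tgt.2 = 0 ∧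
      (run start L).tgt.2 ≠ 0 := by
  obtain ⟨hA, ht⟩ := h
  have hne : L ≠ [] := by rintro rfl; simp at ht
  have hs := hA.src_mem hne
  have hv := valid_run start_valid L
  have hmain : (run start L).dir = (-1, 0) ∧
      2 * (run start L).tgt.1 + (run start L).tgt.2 = 0 := by
    revert hv hs ht
    generalize run start L = D
    obtain ⟨⟨a, b⟩, ⟨c, d⟩⟩ := D
    simp only [halfPlane, Set.mem_ofPred_eq, Dart.Valid, Dart.tgt, IsStep, Prod.mk.injEq,
      Prod.mk_add_mk, Prod.neg_mk]
    omega
  refine ⟨hmain.1, hmain.2, fun h0 => ?_⟩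
  have hsrc : (run start L).src = (1, 0) := by
    have h1 := (run start L).tgt_sub_src
    have h2 : (run start L).tgt = 0 := Prod.ext (by simp only [Prod.fst_zero]; omega) h0
    rw [h2, hmain.1, zero_sub] at h1
    rw [← neg_neg (run start L).src, h1]
    rfl
  match L, hA, hmain, hsrc with
  | [], hA, hmain, _ => simp at hmain
  | [t], hA, hmain, _ => cases t <;> simp at hmain
  | t :: t' :: L, hA, _, hsrc =>
    have h1 := hA.1
    rw [trail_eq_src_cons, hsrc, List.nodup_cons] at h1
    apply h1.1
    have h2 := getLast_tgt_trail start L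
    rw [start_tgt] at h2
    rw [trail_cons, ← h2]
    exact List.getLast_mem _

/-- The winding of an arc is `±π`. -/
lemma wind_of_exitsLeft {L : List Bool} (h : ExitsLeft halfPlane L) :
    wind L = 3 ∨ wind L = -3 := by
  obtain ⟨hdir, ht, hb⟩ := tgt_of_exitsLeft h
  obtain ⟨hA, -⟩ := h
  have hw := dir_run_wind L
  rw [hdir] at hw
  have hmod : wind L % 6 = 3 := by simpa using hw
  suffices |wind L| ≤ 3 by rw [abs_le] at this; omega
  have hnot : (0 : Pt) ∉ trail start L := fun h => by simpa [halfPlane] using hA.2 _ h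
  have hnd : ((run start L).tgt :: (trail start L ++ [start.src])).Nodup := by
    rw [List.nodup_cons, List.nodup_append]
    refine ⟨?_, hA.1, by simp, ?_⟩
    · rw [List.mem_append, List.mem_singleton]
      rintro (h | h)
      · have := hA.2 _ h
        simp only [halfPlane, Set.mem_ofPred_eq] at this
        omega
      · rw [h] at hb
        simp at hb
    · intro p hp' q hq hpq
      rw [List.mem_singleton, start_src] at hq
      exact hnot (hq ▸ hpq ▸ hp')
  obtain ⟨K, hK⟩ := exists_abs_le ((run start L).tgt :: trail start L)
  have hKt := abs_le.1 (hK _ List.mem_cons_self).2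
  -- the vertical boundary line is tilted slightly, such that it passes on the left of the endpoint
  obtain ⟨σ, hσ, hσb⟩ : ∃ σ : ℤ, (σ = 1 ∨ σ = -1) ∧ 0 < σ * (run start L).tgt.2 := by
    rcases lt_or_gt_of_ne hb with h | h
    · exact ⟨-1, by simp, by linarith⟩
    · exact ⟨1, by simp, by linarith⟩
  have hin : ∀ p ∈ trail start L, 2 * K + 1 ≤ (2 * K + 1) * (2 * p.1 + p.2) ∧ |p.2| ≤ K := by
    intro p hp
    have h1 := hA.2 p hp
    simp only [halfPlane, Set.mem_ofPred_eq] at h1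
    have h2 := (hK p (List.mem_cons_of_mem _ hp)).2
    have h3 := abs_nonneg p.2
    exact ⟨le_mul_of_one_le_right (by linarith) h1, h2⟩
  refine abs_wind_le start_valid L hnd (2 * (2 * K + 1)) (2 * K + 1 + σ) (2 * (2 * K + 1))
    (2 * K + 1 - σ) ?_ ?_ ?_ ?_
  · intro p hp
    simp only [start_src, sub_zero]
    rcases List.mem_cons.1 hp with rfl | hp
    · linear_combination hσb - (2 * K + 1) * ht
    · obtain ⟨h1, h2⟩ := hin p hp
      rw [abs_le] at h2
      rcases hσ with rfl | rfl <;> linarith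
  · intro p hp
    rw [List.mem_append, List.mem_singleton] at hp
    simp only [Prod.fst_sub, Prod.snd_sub]
    rcases hp with hp | rfl
    · obtain ⟨h1, h2⟩ := hin p hp
      rw [abs_le] at h2
      have h3 : (2 * K + 1) * (2 * (run start L).tgt.1 + (run start L).tgt.2) = 0 := by
        rw [ht, mul_zero]
      rcases hσ with rfl | rfl <;> linarith
    · simp only [start_src, Prod.fst_zero, Prod.snd_zero]
      linear_combination hσb + (2 * K + 1) * ht
  · apply re_toC_div_nonneg
    simp only [start_src, sub_zero, start_dir]
    linarith
  · apply re_toC_div_nonneg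
    simp only [start_src, sub_zero, hdir]
    linarith

/-! ### The observable in trapezoids and in triangles -/

lemma trapezoid_subset_strip (T N : ℕ) : trapezoid T N ⊆ strip T := fun _ h => h.1

lemma strip_subset_halfPlane (T : ℕ) : strip T ⊆ halfPlane := fun _ h => h.1

lemma triangle_subset_halfPlane (s : ℕ) : triangle s ⊆ halfPlane := fun _ h => h.1

lemma ExitsLeft.mono {Ω Ω' : Set Pt} {L : List Bool} (h : ExitsLeft Ω L) (hs : Ω ⊆ Ω') :
    ExitsLeft Ω' L := ⟨h.1.mono hs, h.2⟩

lemma finite_of_bounds {Ω : Set Pt} (K : ℤ) (h : ∀ p ∈ Ω, |p.1| ≤ K ∧ |p.2| ≤ K) : Ω.Finite := by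
  refine ((Set.finite_Icc (-K) K).prod (Set.finite_Icc (-K) K)).subset fun p hp => ?_
  obtain ⟨h1, h2⟩ := h p hp
  rw [abs_le] at h1 h2
  exact ⟨h1, h2⟩

lemma finite_trapezoid (T N : ℕ) : (trapezoid T N).Finite := by
  refine finite_of_bounds (3 * T + 6 * N) fun p hp => ?_
  simp only [trapezoid, strip, Set.mem_ofPred_eq] at hp
  rw [abs_le, abs_le]
  omega

lemma finite_triangle (s : ℕ) : (triangle s).Finite := by
  refine finite_of_bounds (12 * s + 12) fun p hp => ?_
  simp only [triangle, Set.mem_ofPred_eq] at hp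
  rw [abs_le, abs_le]
  omega

/-- Walks that leave a trapezoid have winding at most `π`, and winding `0` if they leave it to the
right. -/
lemma wind_of_exits_trapezoid {T N : ℕ} (hT : 1 ≤ T) {L : List Bool}
    (h : Exits (trapezoid T N) L) :
    |wind L| ≤ 3 ∧ (ExitsRight T L → wind L = 0) := by
  obtain ⟨hA, ht⟩ := h
  have hne : L ≠ [] := by
    rintro rfl
    apply ht
    simp only [trapezoid, strip, Set.mem_ofPred_eq, run_nil, start_tgt]
    omega
  have hs := hA.src_mem hne
  have hv := valid_run start_valid L
  have hAH := hA.mono ((trapezoid_subset_strip T N).trans (strip_subset_halfPlane T))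
  have hcases : (2 * (run start L).tgt.1 + (run start L).tgt.2 ≤ 0) ∨
      (1 ≤ 2 * (run start L).tgt.1 + (run start L).tgt.2 ∧
      (((run start L).dir = (1, 0) ∧
        3 * (T : ℤ) < 2 * (run start L).tgt.1 + (run start L).tgt.2) ∨
      ((run start L).dir = (-1, 1) ∧ ¬ 3 * (T : ℤ) < 2 * (run start L).tgt.1 + (run start L).tgt.2 ∧
        3 * (N : ℤ) < (run start L).tgt.2 - (run start L).tgt.1) ∨
      ((run start L).dir = (0, -1) ∧ ¬ 3 * (T : ℤ) < 2 * (run start L).tgt.1 + (run start L).tgt.2 ∧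
        3 * (N : ℤ) < -(run start L).tgt.1 - 2 * (run start L).tgt.2))) := by
    revert hv hs ht
    generalize run start L = D
    obtain ⟨⟨a, b⟩, ⟨c, d⟩⟩ := D
    simp only [trapezoid, strip, Set.mem_ofPred_eq, Dart.Valid, Dart.tgt, IsStep, Prod.mk.injEq,
      Prod.mk_add_mk, Prod.neg_mk]
    omega
  rcases hcases with h | ⟨h1, ⟨hd, h⟩ | ⟨hd, hn, h⟩ | ⟨hd, hn, h⟩⟩
  · refine ⟨?_, fun hr => ?_⟩
    · rcases wind_of_exitsLeft ⟨hAH, h⟩ with h | h <;> rw [h] <;> decide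
    · have := hr.2
      omega
  · have hle : |wind L| ≤ 3 := by
      refine abs_wind_le_of_extremal hAH h1 2 1 (fun p hp => ?_) (by linarith) ?_
      · have := hA.2 p hp
        simp only [trapezoid, strip, Set.mem_ofPred_eq] at this
        linarith
      · rw [hd]; linarith
    refine ⟨hle, fun _ => ?_⟩
    have hw := dir_run_wind L
    rw [hd] at hw
    have hmod : wind L % 6 = 0 := by simpa using hw
    rw [abs_le] at hle
    omega
  · refine ⟨abs_wind_le_of_extremal hAH h1 (-1) 1 (fun p hp => ?_) (by linarith) ?_,
      fun hr => absurd hr.2 hn⟩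
    · have := hA.2 p hp
      simp only [trapezoid, strip, Set.mem_ofPred_eq] at this
      linarith
    · rw [hd]; linarith
  · refine ⟨abs_wind_le_of_extremal hAH h1 (-1) (-2) (fun p hp => ?_) (by linarith) ?_,
      fun hr => absurd hr.2 hn⟩
    · have := hA.2 p hp
      simp only [trapezoid, strip, Set.mem_ofPred_eq] at this
      linarith
    · rw [hd]; linarith

/-- Walks leave a triangle through one of its three sides, which determines their winding. -/
lemma exits_triangle_cases {s : ℕ} {L : List Bool} (h : Exits (triangle s) L) :
    (ExitsLeft (triangle s) L ∧ ¬ ExitsUp s L ∧ ¬ ExitsDown s L ∧ (wind L = 3 ∨ wind L = -3)) ∨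
    (¬ ExitsLeft (triangle s) L ∧ ExitsUp s L ∧ ¬ ExitsDown s L ∧ wind L = 1) ∨
    (¬ ExitsLeft (triangle s) L ∧ ¬ ExitsUp s L ∧ ExitsDown s L ∧ wind L = -1) := by
  obtain ⟨hA, ht⟩ := h
  have hne : L ≠ [] := by
    rintro rfl
    apply ht
    simp only [triangle, Set.mem_ofPred_eq, run_nil, start_tgt]
    omega
  have hs := hA.src_mem hne
  have hv := valid_run start_valid L
  have hAH := hA.mono (triangle_subset_halfPlane s)
  have hcases :
      (2 * (run start L).tgt.1 + (run start L).tgt.2 ≤ 0 ∧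
        ¬ 3 * (s : ℤ) + 1 < (run start L).tgt.1 + 2 * (run start L).tgt.2 ∧
        ¬ 3 * (s : ℤ) + 1 < (run start L).tgt.1 - (run start L).tgt.2) ∨
      (1 ≤ 2 * (run start L).tgt.1 + (run start L).tgt.2 ∧
        3 * (s : ℤ) + 1 < (run start L).tgt.1 + 2 * (run start L).tgt.2 ∧
        ¬ 3 * (s : ℤ) + 1 < (run start L).tgt.1 - (run start L).tgt.2 ∧
        (run start L).dir = (0, 1)) ∨
      (1 ≤ 2 * (run start L).tgt.1 + (run start L).tgt.2 ∧
        ¬ 3 * (s : ℤ) + 1 < (run start L).tgt.1 + 2 * (run start L).tgt.2 ∧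
        3 * (s : ℤ) + 1 < (run start L).tgt.1 - (run start L).tgt.2 ∧
        (run start L).dir = (1, -1)) := by
    revert hv hs ht
    generalize run start L = D
    obtain ⟨⟨a, b⟩, ⟨c, d⟩⟩ := D
    simp only [triangle, Set.mem_ofPred_eq, Dart.Valid, Dart.tgt, IsStep, Prod.mk.injEq,
      Prod.mk_add_mk, Prod.neg_mk]
    omega
  have hw := dir_run_wind L
  rcases hcases with ⟨h1, h2, h3⟩ | ⟨h1, h2, h3, hd⟩ | ⟨h1, h2, h3, hd⟩
  · exact Or.inl ⟨⟨hA, h1⟩, fun h => h2 h.2, fun h => h3 h.2, wind_of_exitsLeft ⟨hAH, h1⟩⟩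
  · refine Or.inr (Or.inl ⟨fun h => by have := h.2; omega, ⟨hA, h2⟩, fun h => h3 h.2, ?_⟩)
    have hle : |wind L| ≤ 3 := by
      refine abs_wind_le_of_extremal hAH h1 1 2 (fun p hp => ?_) (by linarith) ?_
      · have := hA.2 p hp
        simp only [triangle, Set.mem_ofPred_eq] at this
        linarith
      · rw [hd]; linarith
    rw [hd] at hw
    have hmod : wind L % 6 = 1 := by simpa using hw
    rw [abs_le] at hle
    omega
  · refine Or.inr (Or.inr ⟨fun h => by have := h.2; omega, fun h => h2 h.2, ⟨hA, h3⟩, ?_⟩)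
    have hle : |wind L| ≤ 3 := by
      refine abs_wind_le_of_extremal hAH h1 1 (-1) (fun p hp => ?_) (by linarith) ?_
      · have := hA.2 p hp
        simp only [triangle, Set.mem_ofPred_eq] at this
        linarith
      · rw [hd]; linarith
    rw [hd] at hw
    have hmod : wind L % 6 = 5 := by simpa using hw
    rw [abs_le] at hle
    omega

/-! ### Partition functions -/

/-- The critical weight of a walk as an extended nonnegative number. -/
noncomputable def critWeight (L : List Bool) : ℝ≥0∞ := ENNReal.ofReal (hexCriticalWeight ^ L.length)

/-- The critical partition function of a set of walks. -/
noncomputable def partition (S : Set (List Bool)) : ℝ≥0∞ := ∑' L : S, critWeight L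

/-- The coefficient `cos (3π/8)` of the arcs in the identities for the observable. -/
noncomputable def arcCoeff : ℝ≥0∞ := ENNReal.ofReal (Real.cos (3 * (Real.pi / 8)))

lemma cos_three_mul_pos : 0 < Real.cos (3 * (Real.pi / 8)) :=
  Real.cos_pos_of_mem_Ioo ⟨by linarith [Real.pi_pos], by linarith [Real.pi_pos]⟩

lemma arcCoeff_ne_zero : arcCoeff ≠ 0 := by
  rw [arcCoeff, ne_eq, ENNReal.ofReal_eq_zero, not_le]
  exact cos_three_mul_pos

lemma critWeight_append (L M : List Bool) :
    critWeight (L ++ M) = critWeight L * critWeight M := by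
  rw [critWeight, critWeight, critWeight, List.length_append, pow_add,
    ENNReal.ofReal_mul (pow_nonneg hexCriticalWeight_pos.le _)]

lemma partition_eq_tsum (S : Set (List Bool)) :
    partition S = ∑' L, S.indicator critWeight L := tsum_subtype S critWeight

lemma partition_mono {S S' : Set (List Bool)} (h : S ⊆ S') : partition S ≤ partition S' :=
  ENNReal.tsum_mono_subtype critWeight h

/-- The partition function of the arcs in `Ω`, which start and end on the left boundary line. -/
noncomputable def arcs (Ω : Set Pt) : ℝ≥0∞ := partition {L | ExitsLeft Ω L}

lemma arcs_mono {Ω Ω' : Set Pt} (h : Ω ⊆ Ω') : arcs Ω ≤ arcs Ω' :=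
  partition_mono fun _ hL => ExitsLeft.mono hL h

lemma exists_bound (S : Finset (List Bool)) :
    ∃ N : ℕ, ∀ L ∈ S, ∀ p ∈ trail start L, |p.1| ≤ N ∧ |p.2| ≤ N := by
  classical
  induction S using Finset.induction_on with
  | empty => exact ⟨0, by simp⟩
  | insert M S _ ih =>
    obtain ⟨N, hN⟩ := ih
    obtain ⟨K, hK⟩ := exists_abs_le (trail start M)
    refine ⟨max N K.toNat, fun L hL p hp => ?_⟩
    have hN' : (N : ℤ) ≤ (max N K.toNat : ℕ) := by exact_mod_cast le_max_left _ _
    have hK' : K ≤ (max N K.toNat : ℕ) :=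
      (Int.self_le_toNat K).trans (by exact_mod_cast le_max_right _ _)
    rcases Finset.mem_insert.1 hL with rfl | hL
    · exact ⟨(hK p hp).1.trans hK', (hK p hp).2.trans hK'⟩
    · exact ⟨(hN L hL p hp).1.trans hN', (hN L hL p hp).2.trans hN'⟩

lemma finite_exits {Ω : Set Pt} (hΩ : Ω.Finite) : {L | Exits Ω L}.Finite :=
  (finite_admissible hΩ).subset fun _ h => And.left h

lemma sum_ofReal_weight_re {Ω : Set Pt} (hΩ : Ω.Finite) (hs : Ω ⊆ halfPlane)
    (E : Finset (List Bool)) (hE : ∀ L, L ∈ E ↔ Exits Ω L) (hw : ∀ L ∈ E, |wind L| ≤ 3) :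
    ∑ L ∈ E, ENNReal.ofReal (weight L).re = 1 := by
  have h0 : (0 : Pt) ∉ Ω := fun h => by simpa [halfPlane] using hs h
  have hsum := sum_weight_exits hΩ h0 2 1 (fun p hp => by
    have := hs hp
    simp only [halfPlane, Set.mem_ofPred_eq] at this
    linarith) E hE
  rw [← ENNReal.ofReal_sum_of_nonneg, ← Complex.re_sum, hsum, Complex.one_re, ENNReal.ofReal_one]
  intro L hL
  rw [weight_re]
  refine mul_nonneg (pow_nonneg hexCriticalWeight_pos.le _) (Real.cos_nonneg_of_mem_Icc ?_)
  have h1 := abs_le.1 (hw L hL)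
  have h2 : (-3 : ℝ) ≤ wind L := by exact_mod_cast h1.1
  have h3 : (wind L : ℝ) ≤ 3 := by exact_mod_cast h1.2
  have := Real.pi_pos
  constructor <;> nlinarith

lemma ofReal_weight_re_of_arc {L : List Bool} (h : wind L = 3 ∨ wind L = -3) :
    ENNReal.ofReal (weight L).re = arcCoeff * critWeight L := by
  rw [weight_re, mul_comm, arcCoeff, critWeight, ← ENNReal.ofReal_mul cos_three_mul_pos.le]
  rcases h with h | h <;> rw [h]
  · norm_num
  · push_cast
    rw [neg_mul, Real.cos_neg]

/-- Arcs and bridges in a strip.  The bound is an equality, but for a contribution of walks that leave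
through the far ends of the strip, which is nonnegative. -/
theorem arcs_add_bridges_le {T : ℕ} (hT : 1 ≤ T) :
    arcCoeff * arcs (strip T) + partition {L | ExitsRight T L} ≤ 1 := by
  classical
  rw [arcs, partition_eq_tsum, partition_eq_tsum, ← ENNReal.tsum_mul_left, ← ENNReal.tsum_add,
    ENNReal.tsum_eq_iSup_sum]
  refine iSup_le fun S => ?_
  obtain ⟨N, hN⟩ := exists_bound S
  obtain ⟨E, hE⟩ : ∃ E : Finset (List Bool), ∀ L, L ∈ E ↔ Exits (trapezoid T N) L :=
    ⟨(finite_exits (finite_trapezoid T N)).toFinset, fun L => by simp⟩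
  rw [← sum_ofReal_weight_re (finite_trapezoid T N)
    ((trapezoid_subset_strip T N).trans (strip_subset_halfPlane T)) E hE
    fun L hL => (wind_of_exits_trapezoid hT ((hE L).1 hL)).1]
  have hmem : ∀ L ∈ S, Admissible (strip T) L → (run start L).tgt ∉ strip T → L ∈ E := by
    intro L hL hA ht
    refine (hE L).2 ⟨⟨hA.1, fun p hp => ⟨hA.2 p hp, ?_⟩⟩, fun h => ht h.1⟩
    obtain ⟨h1, h2⟩ := hN L hL p hp
    rw [abs_le] at h1 h2
    omega
  refine (Finset.sum_le_sum_of_ne_zero (t := E) fun L hL hne => ?_).trans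
    (Finset.sum_le_sum fun L hL => ?_)
  · by_cases h1 : ExitsLeft (strip T) L
    · refine hmem L hL h1.1 fun h => ?_
      have := h.1
      have := h1.2
      omega
    · by_cases h2 : ExitsRight T L
      · refine hmem L hL h2.1 fun h => ?_
        have := h.2
        have := h2.2
        omega
      · simp [Set.indicator, h1, h2] at hne
  · obtain ⟨hw, hr⟩ := wind_of_exits_trapezoid hT ((hE L).1 hL)
    by_cases h1 : ExitsLeft (strip T) L
    · have h2 : ¬ ExitsRight T L := fun h => by
        have := h.2
        have := h1.2
        omega
      rw [ofReal_weight_re_of_arc (wind_of_exitsLeft (h1.mono (strip_subset_halfPlane T)))]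
      simp [Set.indicator, h1, h2]
    · by_cases h2 : ExitsRight T L
      · rw [weight_re, hr h2]
        simp [Set.indicator, h1, h2, critWeight]
      · simp [Set.indicator, h1, h2]

/-- The reflection in the horizontal axis. -/
def conj (p : Pt) : Pt := (p.1 + p.2, -p.2)

lemma run_map_not (L : List Bool) :
    (run start (L.map not)).src = conj (run start L).src ∧
      (run start (L.map not)).dir = conj (run start L).dir := by
  induction L with
  | nil => exact ⟨rfl, rfl⟩
  | cons t L ih =>
    obtain ⟨h1, h2⟩ := ih
    simp only [List.map_cons, run_cons, Dart.step_src, Dart.step_dir, Dart.tgt, h1, h2, conj]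
    cases t <;> simp <;> omega

lemma tgt_run_map_not (L : List Bool) :
    (run start (L.map not)).tgt = conj (run start L).tgt := by
  obtain ⟨h1, h2⟩ := run_map_not L
  simp only [Dart.tgt, h1, h2, conj, Prod.mk_add_mk, Prod.fst_add, Prod.snd_add]
  ext <;> ring

lemma trail_map_not (L : List Bool) : trail start (L.map not) = (trail start L).map conj := by
  induction L with
  | nil => rfl
  | cons t L ih => simp [ih, tgt_run_map_not]

lemma Admissible.map_not {s : ℕ} {L : List Bool} (h : Admissible (triangle s) L) :
    Admissible (triangle s) (L.map not) := by
  refine ⟨?_, fun p hp => ?_⟩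
  · rw [trail_map_not]
    refine h.1.map fun p q hpq => ?_
    simp only [conj, Prod.mk.injEq] at hpq
    exact Prod.ext (by omega) (by omega)
  · rw [trail_map_not, List.mem_map] at hp
    obtain ⟨q, hq, rfl⟩ := hp
    have := h.2 q hq
    simp only [triangle, Set.mem_ofPred_eq, conj] at this ⊢
    omega

lemma ExitsUp.map_not {s : ℕ} {L : List Bool} (h : ExitsUp s L) : ExitsDown s (L.map not) := by
  refine ⟨h.1.map_not, ?_⟩
  have := h.2
  rw [tgt_run_map_not]
  simp only [conj]
  omega

lemma ExitsDown.map_not {s : ℕ} {L : List Bool} (h : ExitsDown s L) : ExitsUp s (L.map not) := by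
  refine ⟨h.1.map_not, ?_⟩
  have := h.2
  rw [tgt_run_map_not]
  simp only [conj]
  omega

/-- The partition function of the walks that leave a triangle through its upper side. -/
noncomputable def upSum (s : ℕ) : ℝ≥0∞ := partition {L | ExitsUp s L}

lemma partition_exitsDown (s : ℕ) : partition {L | ExitsDown s L} = upSum s := by
  let e : {L | ExitsDown s L} ≃ {L | ExitsUp s L} :=
    { toFun := fun L => ⟨L.1.map not, ExitsDown.map_not L.2⟩
      invFun := fun L => ⟨L.1.map not, ExitsUp.map_not L.2⟩
      left_inv := fun L => by simp [Function.comp_def]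
      right_inv := fun L => by simp [Function.comp_def] }
  rw [upSum, partition, partition, ← e.tsum_eq]
  refine tsum_congr fun L => ?_
  simp [e, critWeight]

/-- The observable in a triangle: by symmetry, the walks that leave through the two sides that do not
contain the origin contribute equally. -/
theorem arcs_add_upSum (s : ℕ) :
    arcCoeff * arcs (triangle s) + ENNReal.ofReal (2 * Real.cos (Real.pi / 8)) * upSum s = 1 := by
  classical
  have hcos : 0 ≤ Real.cos (Real.pi / 8) :=
    Real.cos_nonneg_of_mem_Icc ⟨by linarith [Real.pi_pos], by linarith [Real.pi_pos]⟩
  obtain ⟨E, hE⟩ : ∃ E : Finset (List Bool), ∀ L, L ∈ E ↔ Exits (triangle s) L :=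
    ⟨(finite_exits (finite_triangle s)).toFinset, fun L => by simp⟩
  have hout : ∀ L, L ∉ E → ¬ ExitsLeft (triangle s) L ∧ ¬ ExitsUp s L ∧ ¬ ExitsDown s L := by
    intro L hL
    rw [hE] at hL
    refine ⟨fun h => hL ⟨h.1, fun h' => ?_⟩, fun h => hL ⟨h.1, fun h' => ?_⟩,
      fun h => hL ⟨h.1, fun h' => ?_⟩⟩ <;>
    · have h1 := h.2
      simp only [triangle, Set.mem_ofPred_eq] at h'
      omega
  have h2 : ENNReal.ofReal (2 * Real.cos (Real.pi / 8)) * upSum s =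
      ENNReal.ofReal (Real.cos (Real.pi / 8)) * partition {L | ExitsUp s L} +
      ENNReal.ofReal (Real.cos (Real.pi / 8)) * partition {L | ExitsDown s L} := by
    rw [partition_exitsDown, two_mul, ENNReal.ofReal_add hcos hcos, add_mul]
    rfl
  rw [h2, arcs, partition_eq_tsum, partition_eq_tsum, partition_eq_tsum, ← ENNReal.tsum_mul_left,
    ← ENNReal.tsum_mul_left, ← ENNReal.tsum_mul_left, ← ENNReal.tsum_add, ← ENNReal.tsum_add,
    tsum_eq_sum (s := E)]
  · rw [← sum_ofReal_weight_re (finite_triangle s) (triangle_subset_halfPlane s) E hE ?_]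
    · refine Finset.sum_congr rfl fun L hL => ?_
      have hmul : ∀ w : ℤ, (w = 1 ∨ w = -1) → wind L = w → ENNReal.ofReal (weight L).re =
          ENNReal.ofReal (Real.cos (Real.pi / 8)) * critWeight L := by
        intro w hw h
        rw [weight_re, h, mul_comm, critWeight, ← ENNReal.ofReal_mul hcos]
        rcases hw with rfl | rfl
        · simp
        · push_cast
          rw [neg_mul, Real.cos_neg, one_mul]
      rcases exits_triangle_cases ((hE L).1 hL) with ⟨h1, h2, h3, hw⟩ | ⟨h1, h2, h3, hw⟩ |
        ⟨h1, h2, h3, hw⟩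
      · rw [ofReal_weight_re_of_arc hw]
        simp [Set.indicator, h1, h2, h3]
      · rw [hmul 1 (by simp) hw]
        simp [Set.indicator, h1, h2, h3]
      · rw [hmul (-1) (by simp) hw]
        simp [Set.indicator, h1, h2, h3]
    · intro L hL
      rcases exits_triangle_cases ((hE L).1 hL) with ⟨-, -, -, h | h⟩ | ⟨-, -, -, h⟩ |
        ⟨-, -, -, h⟩ <;> rw [h] <;> decide
  · intro L hL
    obtain ⟨h1, h2, h3⟩ := hout L hL
    simp [Set.indicator, h1, h2, h3]

/-- The part of the total `1` that the arcs of a strip leave to all other walks. -/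
noncomputable def deficit (T : ℕ) : ℝ≥0∞ := 1 - arcCoeff * arcs (strip T)

lemma strip_mono : Monotone strip := fun T T' h p hp => by
  simp only [strip, Set.mem_ofPred_eq] at hp ⊢
  omega

lemma deficit_antitone : Antitone deficit := fun _ _ h =>
  tsub_le_tsub_left (mul_le_mul_right (arcs_mono (strip_mono h)) _) _

lemma deficit_le_one (T : ℕ) : deficit T ≤ 1 := tsub_le_self

lemma partition_exitsRight_le {T : ℕ} (hT : 1 ≤ T) : partition {L | ExitsRight T L} ≤ deficit T :=
  ENNReal.le_sub_of_add_le_left (ne_top_of_le_ne_top ENNReal.one_ne_top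
    (le_self_add.trans (arcs_add_bridges_le hT))) (arcs_add_bridges_le hT)

lemma triangle_subset_strip (s : ℕ) : triangle s ⊆ strip (2 * s + 1) := fun p hp => by
  simp only [triangle, strip, Set.mem_ofPred_eq] at hp ⊢
  push_cast
  omega

/-- The arcs in a triangle are arcs in any strip that contains it.  So what the arcs of the strip leave
of the total `1` must be contributed by the walks that cross the triangle. -/
lemma deficit_le_upSum (s : ℕ) :
    ENNReal.ofReal hexCriticalWeight * deficit (2 * s + 1) ≤ upSum s := by
  have h1 := arcs_add_upSum s
  have hx := two_mul_cos_mul_hexCriticalWeight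
  have hcos : 0 ≤ 2 * Real.cos (Real.pi / 8) := by
    have := hexCriticalWeight_pos
    by_contra h
    nlinarith
  have h2 : upSum s = ENNReal.ofReal hexCriticalWeight *
      (ENNReal.ofReal (2 * Real.cos (Real.pi / 8)) * upSum s) := by
    rw [← mul_assoc, ← ENNReal.ofReal_mul hexCriticalWeight_pos.le, mul_comm hexCriticalWeight,
      hx, ENNReal.ofReal_one, one_mul]
  rw [h2]
  refine mul_le_mul_right ?_ _
  rw [deficit, tsub_le_iff_left, ← h1]
  exact add_le_add_left (mul_le_mul_right (arcs_mono (triangle_subset_strip s)) _) _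

lemma arcs_halfPlane_le : arcCoeff * arcs halfPlane ≤ 1 := by
  classical
  rw [arcs, partition_eq_tsum, ENNReal.tsum_eq_iSup_sum, ENNReal.mul_iSup]
  refine iSup_le fun S => ?_
  obtain ⟨N, hN⟩ := exists_bound S
  refine le_trans ?_ (le_self_add.trans (arcs_add_bridges_le (T := N + 1) (by omega)))
  refine mul_le_mul_right ?_ _
  rw [arcs, partition_eq_tsum]
  refine le_trans (Finset.sum_le_sum fun L hL => ?_) (ENNReal.sum_le_tsum S)
  by_cases h : ExitsLeft halfPlane L
  · have h' : ExitsLeft (strip (N + 1)) L := by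
      refine ⟨⟨h.1.1, fun p hp => ⟨h.1.2 p hp, ?_⟩⟩, h.2⟩
      obtain ⟨h1, h2⟩ := hN L hL p hp
      rw [abs_le] at h1 h2
      push_cast
      omega
    simp [Set.indicator, h, h']
  · simp [Set.indicator, h]

/-! ### Three walks around a corner -/

/-- The product `d z` in `ℤ[ω]`. -/
def emul (d z : Pt) : Pt := (d.1 * z.1 - d.2 * z.2, d.1 * z.2 + d.2 * z.1 + d.2 * z.2)

/-- The point that an observer at the start of `D`, looking along `D`, sees where an observer at the
origin who looks to the right sees `p`. -/
def place (D : Dart) (p : Pt) : Pt := D.src + emul D.dir p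

lemma run_eq_place (D : Dart) (L : List Bool) :
    (run D L).src = place D (run start L).src ∧
      (run D L).dir = emul D.dir (run start L).dir := by
  induction L with
  | nil => constructor <;> ext <;> simp [place, emul]
  | cons t L ih =>
    obtain ⟨h1, h2⟩ := ih
    simp only [run_cons, Dart.step_src, Dart.step_dir, Dart.tgt, h1, h2]
    constructor
    · ext <;> simp [place, emul] <;> ring
    · ext <;> cases t <;> simp [emul] <;> ring

lemma tgt_run_eq_place (D : Dart) (L : List Bool) :
    (run D L).tgt = place D (run start L).tgt := by
  obtain ⟨h1, h2⟩ := run_eq_place D L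
  simp only [Dart.tgt, h1, h2]
  ext <;> simp [place, emul] <;> ring

lemma trail_eq_place (D : Dart) (L : List Bool) :
    trail D L = (trail start L).map (place D) := by
  induction L with
  | nil => rfl
  | cons t L ih => simp [ih, tgt_run_eq_place D L]

lemma place_of_dir_one {D : Dart} (h : D.dir = (0, 1)) (p : Pt) :
    place D p = (D.src.1 - p.2, D.src.2 + p.1 + p.2) := by
  ext <;> simp [place, emul, h] <;> ring

lemma place_of_dir_two {D : Dart} (h : D.dir = (-1, 1)) (p : Pt) :
    place D p = (D.src.1 - p.1 - p.2, D.src.2 + p.1) := by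
  ext
  · simp [place, emul, h]
    ring
  · simp [place, emul, h]

lemma ExitsUp.run_start {s : ℕ} {L : List Bool} (h : ExitsUp s L) :
    (run start L).dir = (0, 1) ∧
      (run start L).src.1 + 2 * (run start L).src.2 = 3 * (s : ℤ) + 1 ∧
      0 ≤ (run start L).src.2 ∧ (run start L).src.2 ≤ 2 * (s : ℤ) := by
  obtain ⟨hA, ht⟩ := h
  have hne : L ≠ [] := by
    rintro rfl
    simp only [run_nil, start_tgt] at ht
    omega
  have hs := hA.src_mem hne
  have hv := valid_run start_valid L
  revert hv hs ht
  generalize run start L = D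
  obtain ⟨⟨a, b⟩, ⟨c, d⟩⟩ := D
  simp only [triangle, Set.mem_ofPred_eq, Dart.Valid, Dart.tgt, IsStep, Prod.mk.injEq,
    Prod.mk_add_mk, Prod.neg_mk]
  omega

/-- The size of the triangle that stands on the upper side of a triangle of size `s`, has the upper
left corner of that triangle as its left corner, and has the exit of the walk `L` as the midpoint
of its base. -/
def nextSize (s : ℕ) (L : List Bool) : ℕ := (2 * (s : ℤ) - (run start L).src.2).toNat

lemma ExitsUp.nextSize_eq {s : ℕ} {L : List Bool} (h : ExitsUp s L) :
    (nextSize s L : ℤ) = 2 * (s : ℤ) - (run start L).src.2 := by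
  have := h.run_start
  rw [nextSize, Int.toNat_of_nonneg (by omega)]

lemma ExitsUp.nextSize_le {s : ℕ} {L : List Bool} (h : ExitsUp s L) : nextSize s L ≤ 2 * s := by
  have := h.run_start
  have := h.nextSize_eq
  omega

/-- The arcs that end at a height of order `s`. -/
def arcsAt (s : ℕ) : Set (List Bool) :=
  {L | ExitsLeft halfPlane L ∧ 2 * (s : ℤ) + 2 ≤ (run start L).tgt.2 ∧
    (run start L).tgt.2 ≤ 18 * (s : ℤ) + 2}

/-- Three walks through triangles with a common corner, each of which starts where the previous one
ends, form an arc: the triangles lie in three sectors of angle `π/3` at that corner, which together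
make up a half-plane. -/
lemma glue_mem_arcsAt {s : ℕ} {L₁ L₂ L₃ : List Bool} (h₁ : ExitsUp s L₁)
    (h₂ : ExitsUp (nextSize s L₁) L₂) (h₃ : ExitsUp (nextSize (nextSize s L₁) L₂) L₃) :
    L₃ ++ (L₂ ++ L₁) ∈ arcsAt s := by
  obtain ⟨d1, e1, e1', e1''⟩ := h₁.run_start
  obtain ⟨d2, e2, e2', e2''⟩ := h₂.run_start
  obtain ⟨d3, e3, e3', e3''⟩ := h₃.run_start
  have n1 := h₁.nextSize_eq
  have n2 := h₂.nextSize_eq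
  generalize hs2 : nextSize s L₁ = s₂ at *
  generalize nextSize s₂ L₂ = s₃ at *
  obtain ⟨⟨hnd1, hin1⟩, -⟩ := h₁
  obtain ⟨⟨hnd2, hin2⟩, -⟩ := h₂
  obtain ⟨⟨hnd3, hin3⟩, ht3⟩ := h₃
  obtain ⟨D, hD⟩ : ∃ D, D = run start L₁ := ⟨_, rfl⟩
  obtain ⟨E, hE⟩ : ∃ E, E = run D L₂ := ⟨_, rfl⟩
  rw [← hD] at d1 e1 e1' e1'' n1
  have hEs := (run_eq_place D L₂).1
  have hEd := (run_eq_place D L₂).2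
  rw [← hE] at hEs hEd
  rw [place_of_dir_one d1] at hEs
  rw [d1, d2] at hEd
  replace hEd : E.dir = (-1, 1) := hEd
  have hEs1 := congrArg Prod.fst hEs
  have hEs2 := congrArg Prod.snd hEs
  simp only at hEs1 hEs2
  have htr : trail start (L₃ ++ (L₂ ++ L₁)) =
      (trail start L₃).map (place E) ++ ((trail start L₂).map (place D) ++ trail start L₁) := by
    rw [trail_append, trail_append, run_append, ← hD, ← hE, trail_eq_place E, trail_eq_place D]
  have htgt : (run start (L₃ ++ (L₂ ++ L₁))).tgt = place E (run start L₃).tgt := by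
    rw [run_append, run_append, ← hD, ← hE, tgt_run_eq_place]
  have htgt3 : (run start L₃).tgt = ((run start L₃).src.1, (run start L₃).src.2 + 1) := by
    rw [Dart.tgt, d3]
    ext <;> simp
  -- the three sectors
  have r1 : ∀ p ∈ trail start L₁, 1 ≤ 2 * p.1 + p.2 ∧ p.1 + 2 * p.2 ≤ 3 * (s : ℤ) + 1 :=
    fun p hp => ⟨(hin1 p hp).1, (hin1 p hp).2.1⟩
  have r2 : ∀ p ∈ (trail start L₂).map (place D),
      3 * (s : ℤ) + 2 ≤ p.1 + 2 * p.2 ∧ p.2 - p.1 ≤ 3 * (s : ℤ) := by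
    intro p hp
    obtain ⟨q, hq, rfl⟩ := List.mem_map.1 hp
    have := hin2 q hq
    simp only [triangle, Set.mem_ofPred_eq] at this
    rw [place_of_dir_one d1]
    simp only
    omega
  have r3 : ∀ p ∈ (trail start L₃).map (place E),
      3 * (s : ℤ) + 1 ≤ p.2 - p.1 ∧ 1 ≤ 2 * p.1 + p.2 := by
    intro p hp
    obtain ⟨q, hq, rfl⟩ := List.mem_map.1 hp
    have := hin3 q hq
    simp only [triangle, Set.mem_ofPred_eq] at this
    rw [place_of_dir_two hEd]
    simp only
    omega
  refine ⟨⟨⟨?_, ?_⟩, ?_⟩, ?_⟩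
  · rw [htr, List.nodup_append, List.nodup_append]
    refine ⟨hnd3.map fun p q hpq => ?_, ⟨hnd2.map fun p q hpq => ?_, hnd1, ?_⟩, ?_⟩
    · rw [place_of_dir_two hEd, place_of_dir_two hEd, Prod.mk.injEq] at hpq
      exact Prod.ext (by omega) (by omega)
    · rw [place_of_dir_one d1, place_of_dir_one d1, Prod.mk.injEq] at hpq
      exact Prod.ext (by omega) (by omega)
    · rintro p hp q hq rfl
      have := r1 p hq
      have := r2 p hp
      omega
    · rintro p hp q hq rfl
      have h3 := r3 p hp
      rcases List.mem_append.1 hq with hq | hq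
      · have := r2 p hq
        omega
      · have := r1 p hq
        omega
  · intro p hp
    rw [htr, List.mem_append, List.mem_append] at hp
    simp only [halfPlane, Set.mem_ofPred_eq]
    rcases hp with hp | hp | hp
    · exact (r3 p hp).2
    · have := r2 p hp
      omega
    · exact (r1 p hp).1
  · rw [htgt, place_of_dir_two hEd, htgt3]
    simp only
    omega
  · rw [htgt, place_of_dir_two hEd, htgt3]
    simp only
    omega

/-- A walk is cut in a unique way at its first exit from a triangle. -/
lemma ExitsUp.append_inj {s : ℕ} {L L' A A' : List Bool} (h : ExitsUp s L) (h' : ExitsUp s L')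
    (he : A ++ L = A' ++ L') : L = L' ∧ A = A' := by
  have aux : ∀ {M M' a : List Bool}, ExitsUp s M → ExitsUp s M' → M = a ++ M' → a = [] := by
    intro M M' a hM hM' ha
    rcases List.eq_nil_or_concat a with h | ⟨b, t, h⟩
    · exact h
    · exfalso
      rw [h, List.concat_eq_append, List.append_assoc, List.singleton_append] at ha
      have h1 := hM.1.2 _ (mem_trail_iff.2 ⟨_, _, _, ha, rfl⟩)
      have h2 := hM'.2
      simp only [triangle, Set.mem_ofPred_eq] at h1
      omega
  rcases List.append_eq_append_iff.1 he with ⟨a, h1, h2⟩ | ⟨a, h1, h2⟩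
  · obtain rfl := aux h h' h2
    simp_all
  · obtain rfl := aux h' h h2
    simp_all

/-- Three crossings of triangles make an arc, so that the deficits bound arcs from below. -/
theorem deficit_pow_three_le (s : ℕ) :
    (ENNReal.ofReal hexCriticalWeight * deficit (8 * s + 1)) ^ 3 ≤ partition (arcsAt s) := by
  set κ := ENNReal.ofReal hexCriticalWeight * deficit (8 * s + 1) with hκ
  have hup : ∀ r, r ≤ 4 * s → κ ≤ upSum r := fun r hr =>
    (mul_le_mul_right (deficit_antitone (by omega)) _).trans (deficit_le_upSum r)
  let T := Σ L₁ : {L | ExitsUp s L}, Σ L₂ : {L | ExitsUp (nextSize s L₁) L},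
    {L | ExitsUp (nextSize (nextSize s L₁) L₂) L}
  let f : T → arcsAt s := fun x => ⟨x.2.2.1 ++ (x.2.1.1 ++ x.1.1),
    glue_mem_arcsAt x.1.2 x.2.1.2 x.2.2.2⟩
  have hf : Function.Injective f := by
    rintro ⟨⟨L₁, h₁⟩, ⟨L₂, h₂⟩, ⟨L₃, h₃⟩⟩ ⟨⟨L₁', h₁'⟩, ⟨L₂', h₂'⟩, ⟨L₃', h₃'⟩⟩ h
    have he : L₃ ++ (L₂ ++ L₁) = L₃' ++ (L₂' ++ L₁') := congrArg Subtype.val h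
    rw [← List.append_assoc, ← List.append_assoc] at he
    obtain ⟨rfl, he'⟩ := ExitsUp.append_inj h₁ h₁' he
    obtain ⟨rfl, rfl⟩ := ExitsUp.append_inj h₂ h₂' he'
    rfl
  have h1 : ∑' x : T, critWeight (f x) ≤ partition (arcsAt s) :=
    ENNReal.tsum_comp_le_tsum_of_injective hf fun L : arcsAt s => critWeight L
  refine le_trans ?_ h1
  rw [ENNReal.tsum_sigma']
  calc κ ^ 3 ≤ κ * (κ * upSum s) := by
        rw [pow_three]
        exact mul_le_mul_right (mul_le_mul_right (hup s (by omega)) _) _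
    _ = ∑' L₁ : {L | ExitsUp s L}, κ * (κ * critWeight L₁) := by
        rw [ENNReal.tsum_mul_left, ENNReal.tsum_mul_left]; rfl
    _ ≤ _ := by
        refine ENNReal.tsum_le_tsum fun L₁ => ?_
        have s2 := ExitsUp.nextSize_le L₁.2
        rw [ENNReal.tsum_sigma']
        calc κ * (κ * critWeight L₁) ≤ κ * (upSum (nextSize s L₁) * critWeight L₁) :=
              mul_le_mul_right (mul_le_mul_left (hup _ (by omega)) _) _
          _ = ∑' L₂ : {L | ExitsUp (nextSize s L₁) L}, κ * (critWeight L₂ * critWeight L₁) := by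
              rw [ENNReal.tsum_mul_left, ENNReal.tsum_mul_right]; rfl
          _ ≤ _ := by
              refine ENNReal.tsum_le_tsum fun L₂ => ?_
              have s3 := ExitsUp.nextSize_le L₂.2
              calc κ * (critWeight L₂ * critWeight L₁)
                  ≤ upSum (nextSize (nextSize s L₁) L₂) * (critWeight L₂ * critWeight L₁) :=
                    mul_le_mul_left (hup _ (by omega)) _
                _ = ∑' L₃ : {L | ExitsUp (nextSize (nextSize s L₁) L₂) L},
                      critWeight L₃ * (critWeight L₂ * critWeight L₁) := by
                    rw [ENNReal.tsum_mul_right]; rfl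
                _ = _ := by
                    refine tsum_congr fun L₃ => ?_
                    rw [← critWeight_append, ← critWeight_append]

/-! ### Summation over scales -/

/-- The scales `s` at which an arc is counted lie between a ninth of its height and its height. -/
lemma tsum_scales_le (L : List Bool) :
    ∑' s : ℕ, ((s + 1 : ℕ) : ℝ≥0∞)⁻¹ * (arcsAt (s + 1)).indicator critWeight L ≤
      9 * {L | ExitsLeft halfPlane L}.indicator critWeight L := by
  classical
  by_cases h : ExitsLeft halfPlane L
  swap
  · have h' : ∀ s, L ∉ arcsAt (s + 1) := fun s hs => h hs.1
    simp [Set.indicator, h']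
  obtain ⟨m, hm⟩ : ∃ m : ℕ, m = (((run start L).tgt.2 - 2) / 2).toNat := ⟨_, rfl⟩
  have hout : ∀ s ∉ Finset.range m, L ∉ arcsAt (s + 1) := by
    intro s hs hL
    have := hL.2
    rw [Finset.mem_range] at hs
    push_cast at this
    omega
  rw [tsum_eq_sum (s := Finset.range m) fun s hs => by simp [Set.indicator, hout s hs]]
  have hterm : ∀ s ∈ Finset.range m,
      ((s + 1 : ℕ) : ℝ≥0∞)⁻¹ * (arcsAt (s + 1)).indicator critWeight L ≤
        9 * (m : ℝ≥0∞)⁻¹ * critWeight L := by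
    intro s _
    by_cases hL : L ∈ arcsAt (s + 1)
    · rw [Set.indicator_of_mem hL]
      refine mul_le_mul_left ?_ _
      have hle : m ≤ 9 * (s + 1) := by
        have := hL.2
        push_cast at this
        omega
      have hle' : (m : ℝ≥0∞) ≤ 9 * ((s + 1 : ℕ) : ℝ≥0∞) := by exact_mod_cast hle
      calc ((s + 1 : ℕ) : ℝ≥0∞)⁻¹ = 9 * (9 * ((s + 1 : ℕ) : ℝ≥0∞))⁻¹ := by
            rw [ENNReal.mul_inv (by simp) (by simp), ← mul_assoc,
              ENNReal.mul_inv_cancel (by simp) (by simp), one_mul]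
        _ ≤ 9 * (m : ℝ≥0∞)⁻¹ := mul_le_mul_right (ENNReal.inv_le_inv.2 hle') _
    · rw [Set.indicator_of_notMem hL, mul_zero]
      exact zero_le
  refine (Finset.sum_le_sum hterm).trans ?_
  rw [Finset.sum_const, Finset.card_range, nsmul_eq_mul,
    Set.indicator_of_mem (show L ∈ {L | ExitsLeft halfPlane L} from h)]
  calc (m : ℝ≥0∞) * (9 * (m : ℝ≥0∞)⁻¹ * critWeight L)
      = 9 * ((m : ℝ≥0∞) * (m : ℝ≥0∞)⁻¹) * critWeight L := by ring
    _ ≤ 9 * 1 * critWeight L :=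
        mul_le_mul_left (mul_le_mul_right (ENNReal.mul_inv_le_one _) _) _
    _ = 9 * critWeight L := by rw [mul_one]

lemma arcs_halfPlane_ne_top : arcs halfPlane ≠ ⊤ := by
  intro h
  have := arcs_halfPlane_le
  rw [h, ENNReal.mul_top arcCoeff_ne_zero] at this
  exact absurd this (by simp)

lemma tsum_deficit_sparse :
    ∑' s : ℕ, ((s + 1 : ℕ) : ℝ≥0∞)⁻¹ * deficit (8 * (s + 1) + 1) ^ 3 ≠ ⊤ := by
  have hx : ENNReal.ofReal hexCriticalWeight ^ 3 ≠ 0 :=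
    pow_ne_zero _ (by simpa using hexCriticalWeight_pos)
  have h1 : ENNReal.ofReal hexCriticalWeight ^ 3 *
      ∑' s : ℕ, ((s + 1 : ℕ) : ℝ≥0∞)⁻¹ * deficit (8 * (s + 1) + 1) ^ 3 ≤ 9 * arcs halfPlane := by
    rw [← ENNReal.tsum_mul_left]
    calc _ ≤ ∑' s : ℕ, ((s + 1 : ℕ) : ℝ≥0∞)⁻¹ * partition (arcsAt (s + 1)) := by
          refine ENNReal.tsum_le_tsum fun s => ?_
          rw [mul_left_comm, ← mul_pow]
          exact mul_le_mul_right (deficit_pow_three_le (s + 1)) _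
      _ = ∑' L, ∑' s : ℕ, ((s + 1 : ℕ) : ℝ≥0∞)⁻¹ * (arcsAt (s + 1)).indicator critWeight L := by
          rw [ENNReal.tsum_comm]
          refine tsum_congr fun s => ?_
          rw [partition_eq_tsum, ENNReal.tsum_mul_left]
      _ ≤ ∑' L, 9 * {L | ExitsLeft halfPlane L}.indicator critWeight L :=
          ENNReal.tsum_le_tsum tsum_scales_le
      _ = 9 * arcs halfPlane := by rw [ENNReal.tsum_mul_left, arcs, partition_eq_tsum]
  intro h
  rw [h, ENNReal.mul_top hx, top_le_iff] at h1
  exact ENNReal.mul_ne_top (by simp) arcs_halfPlane_ne_top h1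

/-- The deficits satisfy the summability that is claimed for bridges. -/
theorem tsum_deficit_ne_top : ∑' n : ℕ, ((n + 1 : ℕ) : ℝ≥0∞)⁻¹ * deficit (n + 1) ^ 3 ≠ ⊤ := by
  let h : ℕ → ℝ≥0∞ := fun q =>
    if q = 0 then 1 else ((q : ℕ) : ℝ≥0∞)⁻¹ * deficit (8 * q + 1) ^ 3
  have h1 : ∀ n : ℕ, ((n + 1 : ℕ) : ℝ≥0∞)⁻¹ * deficit (n + 1) ^ 3 ≤ h (n / 8) := by
    intro n
    by_cases hq : n / 8 = 0
    · simp only [h, hq, if_true]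
      refine mul_le_one' ?_ (pow_le_one₀ zero_le (deficit_le_one _))
      rw [ENNReal.inv_le_one]
      exact_mod_cast Nat.succ_le_succ (Nat.zero_le n)
    · simp only [h, hq, if_false]
      refine mul_le_mul' (ENNReal.inv_le_inv.2 ?_)
        (pow_le_pow_left₀ zero_le (deficit_antitone (by omega)) 3)
      exact_mod_cast (Nat.div_le_self n 8).trans (Nat.le_succ n)
  have h2 : ∑' n : ℕ, h (n / 8) = ∑' q : ℕ, 8 * h q := by
    rw [← (Nat.divModEquiv 8).symm.tsum_eq, ENNReal.tsum_prod']
    refine tsum_congr fun q => ?_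
    have : ∀ r : Fin 8, (Nat.divModEquiv 8).symm (q, r) / 8 = q := fun r => by
      have := r.2
      simp only [Nat.divModEquiv_symm_apply]
      omega
    simp only [this]
    simp
  have h3 : ∑' q : ℕ, h q ≠ ⊤ := by
    rw [tsum_eq_zero_add' ENNReal.summable]
    exact ENNReal.add_ne_top.2 ⟨by simp [h], by simpa [h] using tsum_deficit_sparse⟩
  refine ne_top_of_le_ne_top ?_ (ENNReal.tsum_le_tsum h1)
  rw [h2, ENNReal.tsum_mul_left]
  exact ENNReal.mul_ne_top (by simp) h3

/-! ### Bridges as lists of turns -/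

/-- The grid point of a vertex of the hexagonal lattice.  The origin is the midpoint of the edge from
`(0, 0)` to `(1, 0)`. -/
def pos : HexVertex → Pt
  | .left k n => (2 * k + 1 - n, 2 * n - k)
  | .right k n => (2 * k + 2 - n, 2 * n - k - 1)

lemma pos_injective : Function.Injective pos := by
  intro u v h
  cases u <;> cases v <;> simp only [pos, Prod.mk.injEq] at h
  · congr 1 <;> omega
  · omega
  · omega
  · congr 1 <;> omega

lemma adj_pos {u v : HexVertex} (h : hexLattice.Adj u v) : Adj (pos u) (pos v) := by
  cases u <;> cases v <;> simp only [hexLattice, HexVertex.Adj] at h <;>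
    simp only [Adj, IsStep, pos, Prod.mk_sub_mk, Prod.mk.injEq] <;> omega

lemma col_pos (v : HexVertex) :
    3 * v.col + 2 ≤ 2 * (pos v).1 + (pos v).2 ∧ 2 * (pos v).1 + (pos v).2 ≤ 3 * v.col + 3 := by
  cases v <;> simp only [pos, HexVertex.col] <;> omega

lemma exists_turn {D : Dart} (hD : D.Valid) {v : Pt} (h : Adj D.tgt v) (hv : v ≠ D.src) :
    ∃ t, (D.step t).tgt = v := by
  have : (D.step true).tgt = v ∨ (D.step false).tgt = v := by
    obtain ⟨⟨a, b⟩, ⟨c, d⟩⟩ := D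
    obtain ⟨x, y⟩ := v
    simp only [Dart.Valid, Dart.tgt, IsStep, Dart.step, Adj, Prod.mk.injEq, ne_eq, rot_true,
      rot_false, Prod.mk_add_mk, Prod.neg_mk, Prod.mk_sub_mk] at *
    omega
  rcases this with h | h
  exacts [⟨true, h⟩, ⟨false, h⟩]

/-- Every self-avoiding path of vertices from the right end of the first edge is the path of a list of
turns. -/
lemma exists_turns (l : List Pt) (hne : l ≠ []) (hch : l.IsChain Adj) (hnd : l.Nodup)
    (hlast : l.getLast hne = (1, 0)) (h0 : (0 : Pt) ∉ l) :
    ∃ L, (run start L).tgt :: trail start L = l := by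
  induction l with
  | nil => exact absurd rfl hne
  | cons v l ih =>
    cases l with
    | nil => exact ⟨[], by simpa using hlast.symm⟩
    | cons w l =>
      rw [List.isChain_cons_cons] at hch
      rw [List.nodup_cons] at hnd
      rw [List.mem_cons, not_or] at h0
      obtain ⟨L, hL⟩ := ih (by simp) hch.2 hnd.2
        (by rwa [List.getLast_cons (by simp)] at hlast) h0.2
      obtain ⟨rfl, rfl⟩ := List.cons.inj hL
      have hsrc : v ≠ (run start L).src := by
        rintro rfl
        have := src_mem_trail_append start L
        rw [List.mem_append, List.mem_singleton] at this
        rcases this with h | h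
        · exact hnd.1 (List.mem_cons_of_mem _ h)
        · exact h0.1 h.symm
      obtain ⟨t, ht⟩ := exists_turn (valid_run start_valid L) hch.1.symm hsrc
      exact ⟨t :: L, by rw [run_cons, ht, trail_cons]⟩

lemma exists_turns_bridge {T : ℕ} (γ : HexBridge T) :
    ∃ L, ExitsRight T L ∧ trail start L = (γ.walk.support.map pos).reverse := by
  have hstrip : ∀ p ∈ (γ.walk.support.map pos).reverse, p ∈ strip T := by
    intro p hp
    rw [List.mem_reverse, List.mem_map] at hp
    obtain ⟨v, hv, rfl⟩ := hp
    have h1 := γ.inStrip v hv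
    have h2 := col_pos v
    simp only [strip, Set.mem_ofPred_eq]
    omega
  obtain ⟨e, he⟩ : ∃ e, e = pos (.left T γ.row) := ⟨_, rfl⟩
  have hout : 3 * (T : ℤ) < 2 * e.1 + e.2 := by
    have := col_pos (.left T γ.row)
    rw [he]
    simp only [HexVertex.col] at this
    omega
  have hcons : γ.walk.support.map pos = (1, 0) :: γ.walk.support.tail.map pos :=
    congrArg (List.map pos) γ.walk.cons_tail_support.symm
  have hne : (γ.walk.support.map pos).reverse ≠ [] := by
    rw [hcons]
    simp
  have hlast : ∃ l, (γ.walk.support.map pos).reverse =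
      pos (.right ((T : ℤ) - 1) γ.row) :: l := by
    refine ⟨(γ.walk.reverse.support.tail.map pos), ?_⟩
    rw [← List.map_reverse, ← SimpleGraph.Walk.support_reverse]
    exact congrArg (List.map pos) γ.walk.reverse.cons_tail_support.symm
  have hch : (γ.walk.support.map pos).reverse.IsChain Adj := by
    rw [List.isChain_reverse]
    refine (List.isChain_map pos).2 (γ.walk.isChain_adj_support.imp fun u v h => ?_)
    exact (adj_pos h).symm
  obtain ⟨L, hL⟩ := exists_turns (e :: (γ.walk.support.map pos).reverse) (by simp)
    (by
      obtain ⟨l, hl⟩ := hlast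
      rw [hl] at hch ⊢
      rw [List.isChain_cons_cons]
      refine ⟨adj_pos ?_ |> (he ▸ ·), hch⟩
      exact Or.inr (Or.inr ⟨rfl, rfl⟩))
    (by
      rw [List.nodup_cons, List.nodup_reverse]
      refine ⟨fun h => ?_, γ.selfAvoiding.support_nodup.map pos_injective⟩
      have := (hstrip e h).2
      omega)
    (by
      rw [List.getLast_cons hne]
      simp only [hcons, List.getLast_reverse, List.head_cons])
    (by
      rw [List.mem_cons, not_or]
      refine ⟨fun h => ?_, fun h => ?_⟩
      · rw [← h] at hout
        simp at hout
        omega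
      · simpa [strip] using (hstrip 0 h).1)
  obtain ⟨h1, h2⟩ := List.cons.inj hL
  refine ⟨L, ⟨⟨?_, fun p hp => hstrip p (h2 ▸ hp)⟩, by rw [h1]; exact hout⟩, h2⟩
  rw [h2, List.nodup_reverse]
  exact γ.selfAvoiding.support_nodup.map pos_injective

lemma bridgePartition_le (T : ℕ) : bridgePartition T ≤ partition {L | ExitsRight T L} := by
  choose f hf htr using fun γ : HexBridge T => exists_turns_bridge γ
  have hinj : Function.Injective fun γ => (⟨f γ, hf γ⟩ : {L | ExitsRight T L}) := by
    intro γ γ' h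
    have h1 : f γ = f γ' := congrArg Subtype.val h
    have h2 : γ.walk.support = γ'.walk.support := by
      apply List.map_injective_iff.2 pos_injective
      apply List.reverse_injective
      rw [← htr, ← htr, h1]
    obtain ⟨r, w, hw, hs⟩ := γ
    obtain ⟨r', w', hw', hs'⟩ := γ'
    have h3 : HexVertex.right ((T : ℤ) - 1) r = HexVertex.right ((T : ℤ) - 1) r' := by
      rw [← w.getLast_support, ← w'.getLast_support]
      simp only at h2
      simp only [h2]
    obtain rfl := (HexVertex.right.inj h3).2
    obtain rfl := SimpleGraph.Walk.ext_support h2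
    rfl
  refine le_trans (le_of_eq (tsum_congr fun γ => ?_))
    (ENNReal.tsum_comp_le_tsum_of_injective hinj fun L : {L | ExitsRight T L} => critWeight L)
  have hlen : (f γ).length = γ.length := by
    rw [← length_trail start, htr, List.length_reverse, List.length_map,
      SimpleGraph.Walk.length_support]
    rfl
  simp only [critWeight, hlen]

lemma bridgePartition_le_deficit {T : ℕ} (hT : 1 ≤ T) : bridgePartition T ≤ deficit T :=
  (bridgePartition_le T).trans (partition_exitsRight_le hT)

/-! ### Decay of the deficits -/

/-- Cauchy condensation for the deficits. -/
lemma tsum_deficit_two_pow_ne_top : ∑' k : ℕ, deficit (2 ^ k) ^ 3 ≠ ⊤ := by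
  let f : ℕ → ℝ≥0∞ := fun n => if n = 0 then 0 else (n : ℝ≥0∞)⁻¹ * deficit n ^ 3
  have hf : ∀ ⦃m n : ℕ⦄, 1 < m → m ≤ n → f n ≤ f m := by
    intro m n hm hmn
    have h1 : m ≠ 0 := by omega
    have h2 : n ≠ 0 := by omega
    simp only [f, h1, h2, if_false]
    exact mul_le_mul' (ENNReal.inv_le_inv.2 (by exact_mod_cast hmn))
      (pow_le_pow_left₀ zero_le (deficit_antitone hmn) 3)
  have h1 : ∑' n, f n ≠ ⊤ := by
    rw [tsum_eq_zero_add' ENNReal.summable]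
    exact ENNReal.add_ne_top.2 ⟨by simp [f], by simpa [f] using tsum_deficit_ne_top⟩
  have h2 := ENNReal.tsum_condensed_le hf
  have h3 : ∀ k : ℕ, 2 ^ k * f (2 ^ k) = deficit (2 ^ k) ^ 3 := by
    intro k
    have hk : (2 : ℕ) ^ k ≠ 0 := by positivity
    simp only [f, hk, if_false]
    rw [← mul_assoc]
    push_cast
    rw [ENNReal.mul_inv_cancel (by simp) (by simp), one_mul]
  simp only [h3] at h2
  refine ne_top_of_le_ne_top ?_ h2
  refine ENNReal.add_ne_top.2 ⟨?_, ?_⟩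
  · simp only [f, one_ne_zero, if_false]
    refine ENNReal.mul_ne_top (by simp)
      (ENNReal.pow_ne_top (ne_top_of_le_ne_top ENNReal.one_ne_top (deficit_le_one 1)))
  · simpa [nsmul_eq_mul] using ENNReal.mul_ne_top (by simp) h1

lemma tendsto_deficit : Tendsto deficit atTop (𝓝 0) := by
  have h := ENNReal.tendsto_atTop_zero_of_tsum_ne_top tsum_deficit_two_pow_ne_top
  rw [ENNReal.tendsto_atTop_zero] at h ⊢
  intro ε hε
  obtain ⟨k, hk⟩ := h (ε ^ 3) (by positivity)
  refine ⟨2 ^ k, fun n hn => (deficit_antitone hn).trans ?_⟩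
  exact (ENNReal.pow_le_pow_left_iff three_ne_zero).1 (hk k le_rfl)

lemma tsum_inv_nat_add (m : ℕ) : ∑' k : ℕ, ((k + (m + 1) : ℕ) : ℝ≥0∞)⁻¹ = ⊤ := by
  by_contra h
  have h1 : ∀ k : ℕ, ((k + (m + 1) : ℕ) : ℝ≥0∞)⁻¹ =
      ((((k + (m + 1) : ℕ) : NNReal)⁻¹ : NNReal) : ℝ≥0∞) := fun k => by
    rw [ENNReal.coe_inv (by positivity)]
    simp
  simp only [h1] at h
  have h2 := ENNReal.tsum_coe_ne_top_iff_summable.1 h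
  have h3 : Summable fun k : ℕ => (((k + (m + 1) : ℕ) : ℝ))⁻¹ := by
    have := NNReal.summable_coe.2 h2
    simpa using this
  exact Real.not_summable_natCast_inv
    ((summable_nat_add_iff (f := fun n : ℕ => ((n : ℝ))⁻¹) (m + 1)).1 h3)

end HexSAW

open HexSAW in
theorem proposition2 :
    (∑' T : ℕ+, ((T : ℕ) : ℝ≥0∞)⁻¹ * bridgePartition (T : ℕ) ^ 3 < ⊤) ∧
    Tendsto bridgePartition atTop (𝓝 0) ∧
    {T : ℕ | 2 ≤ T ∧
      bridgePartition T < ENNReal.ofReal (1 / Real.log (T : ℝ) ^ (1 / 3 : ℝ))}.Infinite := by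
  refine ⟨?_, ?_, ?_⟩
  · rw [tsum_pnat_eq_tsum_succ (f := fun T : ℕ => (T : ℝ≥0∞)⁻¹ * bridgePartition T ^ 3)]
    refine lt_of_le_of_lt (ENNReal.tsum_le_tsum fun n => ?_) tsum_deficit_ne_top.lt_top
    exact mul_le_mul_right
      (pow_le_pow_left₀ zero_le (bridgePartition_le_deficit (by omega)) 3) _
  · refine tendsto_of_tendsto_of_tendsto_of_le_of_le' tendsto_const_nhds tendsto_deficit
      (Eventually.of_forall fun _ => zero_le) ?_
    filter_upwards [eventually_ge_atTop 1] with T hT using bridgePartition_le_deficit hT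
  · intro hfin
    obtain ⟨m, hm⟩ := hfin.bddAbove
    -- otherwise the deficits along powers of `2` dominate the harmonic series
    have hlow : ∀ k : ℕ, ((k + (m + 1) : ℕ) : ℝ≥0∞)⁻¹ ≤ deficit (2 ^ (k + (m + 1))) ^ 3 := by
      intro k
      set j := k + (m + 1) with hj
      have hj1 : 1 ≤ j := by omega
      have hjm : m < 2 ^ j := lt_of_lt_of_le (by omega) (Nat.lt_two_pow_self (n := j)).le
      have h2 : 2 ≤ 2 ^ j := by
        calc 2 = 2 ^ 1 := by norm_num
          _ ≤ 2 ^ j := Nat.pow_le_pow_right (by norm_num) hj1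
      have hnot : ¬ bridgePartition (2 ^ j) <
          ENNReal.ofReal (1 / Real.log ((2 ^ j : ℕ) : ℝ) ^ (1 / 3 : ℝ)) := fun h =>
        absurd (hm ⟨h2, h⟩) (by omega)
      rw [not_lt] at hnot
      have hd := hnot.trans (bridgePartition_le_deficit (by omega))
      refine le_trans ?_ (pow_le_pow_left₀ zero_le hd 3)
      have hjpos : (0 : ℝ) < j := by exact_mod_cast hj1
      have hlog : 0 < Real.log ((2 ^ j : ℕ) : ℝ) := Real.log_pos (by exact_mod_cast h2)
      have hlogle : Real.log ((2 ^ j : ℕ) : ℝ) ≤ j := by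
        push_cast
        rw [Real.log_pow]
        have := Real.log_two_lt_d9
        nlinarith
      have hcube : (1 / Real.log ((2 ^ j : ℕ) : ℝ) ^ (1 / 3 : ℝ)) ^ 3
          = (Real.log ((2 ^ j : ℕ) : ℝ))⁻¹ := by
        rw [div_pow, one_pow, ← Real.rpow_natCast, ← Real.rpow_mul hlog.le, one_div]
        norm_num
      rw [← ENNReal.ofReal_pow (by positivity), hcube, ← ENNReal.ofReal_natCast,
        ← ENNReal.ofReal_inv_of_pos hjpos]
      exact ENNReal.ofReal_le_ofReal (inv_anti₀ hlog hlogle)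
    refine tsum_deficit_two_pow_ne_top (top_le_iff.1 ?_)
    rw [← tsum_inv_nat_add m]
    exact (ENNReal.tsum_le_tsum hlow).trans
      (ENNReal.tsum_comp_le_tsum_of_injective (add_left_injective (m + 1))
        fun k => deficit (2 ^ k) ^ 3)
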